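/- Let $n\in\mathbb{N}$ and let $H=H(x,p,u):\mathbb{R}^n\times\mathbb{R}^n\times\mathbb{R}\to\mathbb{R}$ satisfy the following assumptions. $(\mathcal H_1)$ $H$ is continuous, nondecreasing in $u$, convex in $p$, and for all compact $K\subset\mathbb{R}^n$, $I\subset\mathbb{R}$, $\lim_{r\to\infty}\inf\{H(x,p,u): x\in K,\ |p|\ge r,\ u\in I\}=+\infty$. $(\mathcal H_2)$ There is $\varepsilon>0$ with $\limsup_{|x|\to\infty}\max_{|p|\le\varepsilon}H(x,p,0)<\max_{x}\min_{p}H(x,p,0)<\infty$. $(\mathcal H_3)$ $H$ is differentiable in $u$, and for every $R>0$ there are constants $0<\underline\kappa_R\le\overline\kappa_R$ with $\underline\kappa_R\le\partial_uH(x,p,u)\le\overline\kappa_R$ for all $x\in\mathbb{R}^n$, $|p|\le R$, $u\in\mathbb{R}$, and a modulus $\omega_R$ (with $\omega_R(r)\to0$ as $r\to0^+$) such that $\left|\frac{H(x,p,u)-H(x,p,0)}{u}-\partial_uH(x,p,0)\right|\le\omega_R(|u|)$ for $|x|,|p|\le R$, $u\ne0$. Assume moreover one of the following. $(\mathcal P_1)$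 $\partial_uH\le\overline\kappa$ everywhere for some constant $\overline\kappa$, and for some $\theta\in(0,1)$ there is $C_\theta>0$ with $H(x,\theta p,u)\le H(x,p,u)+C_\theta$ for all $(x,p,u)$. $(\mathcal P_2)$ $\partial_uH\le\overline\kappa$ everywhere for some constant $\overline\kappa$, $H$ is convex in $(p,u)$, and for some $\theta\in(0,1)$ and every $C\in\mathbb{R}$ there is $C_\theta=C_\theta(C)>0$ such that $H(x,p,\theta u)\le C$ implies $H(x,p,u)\le C_\theta$, for all $(x,p,u)$. $(\mathcal P_3)$ $\sup\{H(x,p,u):x\in\mathbb{R}^n,|p|\le R,|u|\le C\}<\infty$ for all $R,C>0$; $\inf_{x,p}H(x,p,u_0)>-\infty$ for every $u_0\in\mathbb{R}$; and $\lim_{r\to\infty}\inf\{H(x,p,u):x\in\mathbb{R}^n,|p|\ge r,|u|\le C\}=+\infty$ for every $C>0$. Let $c(H)$ be the infimum of all $a\in\mathbb{R}$ for which $H(x,Du,0)=a$ has a continuous viscosity subsolution in $\mathbb{R}^n$. For $\lambda>0$ let $u_\lambda$ be the maximal solution, i.e. the greatest continuous viscosity solution, of $$H(x,Du,\lambda u)=c(H)\quad\text{in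 }\mathbb{R}^n,$$ and for $R>0$ let $\vartheta_{\lambda,R}$ be the state-constraint solution of the same equation in $B_R(0)$, i.e. the function in $C(\overline B_R(0))$ that is a viscosity subsolution in $B_R(0)$ and a viscosity supersolution on $\overline B_R(0)$ (tested at minima of $\vartheta_{\lambda,R}-\varphi$ relative to $\overline B_R(0)$, $\varphi\in C^1(\mathbb{R}^n)$). Then for every $z\in\mathbb{R}^n$ there exist $R_z>0$ and $\lambda_z\in(0,1)$ such that for all $R\ge R_z$ and $\lambda\in(0,\lambda_z)$ the solutions $u_\lambda$ and $\vartheta_{\lambda,R}$ exist and $$u_\lambda(z)=\vartheta_{\lambda,R}(z).$$ -/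

import Mathlib

open Set Filter Topology Metric

namespace HJ

/-- `ℝⁿ` with its Euclidean norm and inner product. -/
abbrev E (n : ℕ) : Type := EuclideanSpace ℝ (Fin n)

/-- Viscosity subsolution of `F(x, Du, u) = c` on the set `S`: the inequality `≤ c` holds whenever
`u - φ`, with `φ ∈ C¹(ℝⁿ)`, has a local maximum relative to `S` at a point of `S`.
(For open `S` this is an ordinary local maximum.) -/
def IsViscositySubsolution {n : ℕ} (F : E n → E n → ℝ → ℝ) (c : ℝ) (S : Set (E n))
    (u : E n → ℝ) : Prop :=
  ∀ φ : E n → ℝ, ContDiff ℝ 1 φ → ∀ x ∈ S, IsLocalMaxOn (fun y => u y - φ y) S x →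
    F x (gradient φ x) (u x) ≤ c

/-- Viscosity supersolution of `F(x, Du, u) = c` on the set `S`. When `S` is the closure of a
domain, minima at boundary points, relative to `S`, are tested too. -/
def IsViscositySupersolution {n : ℕ} (F : E n → E n → ℝ → ℝ) (c : ℝ) (S : Set (E n))
    (u : E n → ℝ) : Prop :=
  ∀ φ : E n → ℝ, ContDiff ℝ 1 φ → ∀ x ∈ S, IsLocalMinOn (fun y => u y - φ y) S x →
    c ≤ F x (gradient φ x) (u x)

/-- The critical value `c(H)`: the infimum of the `a` for which `H(x, Du, 0) = a` has a continuous
viscosity subsolution on `ℝⁿ`. -/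
noncomputable def criticalValue {n : ℕ} (H : E n → E n → ℝ → ℝ) : ℝ :=
  sInf {a : ℝ | ∃ u : E n → ℝ, Continuous u ∧
    IsViscositySubsolution (fun x p _ => H x p 0) a univ u}

/-- `u` is a continuous viscosity solution of `H(x, Du, lam * u) = c(H)` on `ℝⁿ`. -/
def IsGlobalSolution {n : ℕ} (H : E n → E n → ℝ → ℝ) (lam : ℝ) (u : E n → ℝ) : Prop :=
  Continuous u ∧
  IsViscositySubsolution (fun x p r => H x p (lam * r)) (criticalValue H) univ u ∧
  IsViscositySupersolution (fun x p r => H x p (lam * r)) (criticalValue H) univ u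

/-- `u` is the maximal solution: the (pointwise) greatest continuous viscosity solution of
`H(x, Du, lam * u) = c(H)` on `ℝⁿ`. -/
def IsMaximalSolution {n : ℕ} (H : E n → E n → ℝ → ℝ) (lam : ℝ) (u : E n → ℝ) : Prop :=
  IsGreatest {v : E n → ℝ | IsGlobalSolution H lam v} u

/-- `w` is (on the closed ball) a state-constraint solution of `H(x, Dw, lam * w) = c(H)` in the
ball of radius `R` about `0`: continuous on the closed ball, a subsolution in the open ball and a
supersolution on the closed ball. -/
def IsStateConstraintSolution {n : ℕ} (H : E n → E n → ℝ → ℝ) (lam R : ℝ) (w : E n → ℝ) : Prop :=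
  ContinuousOn w (closedBall 0 R) ∧
  IsViscositySubsolution (fun x p r => H x p (lam * r)) (criticalValue H) (ball 0 R) w ∧
  IsViscositySupersolution (fun x p r => H x p (lam * r)) (criticalValue H) (closedBall 0 R) w

/-- Continuity, monotonicity in `u`, convexity in `p`, local coercivity in `p`. -/
structure AssumptionH1 {n : ℕ} (H : E n → E n → ℝ → ℝ) : Prop where
  continuous : Continuous fun q : E n × E n × ℝ => H q.1 q.2.1 q.2.2
  monotone : ∀ x p, Monotone (H x p)
  convex : ∀ x u, ConvexOn ℝ univ fun p => H x p u
  coercive : ∀ K : Set (E n), IsCompact K → ∀ I : Set ℝ, IsCompact I →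
    ∀ M : ℝ, ∃ r : ℝ, ∀ x ∈ K, ∀ u ∈ I, ∀ p, r ≤ ‖p‖ → M ≤ H x p u

/-- For some `ε > 0`,
`limsup_{|x| → ∞} max_{|p| ≤ ε} H(x, p, 0) < max_x min_p H(x, p, 0) < ∞`,
all suprema, infima and limits being taken in the extended reals. -/
def AssumptionH2 {n : ℕ} (H : E n → E n → ℝ → ℝ) : Prop :=
  ∃ ε : ℝ, 0 < ε ∧
    limsup (fun x : E n => ⨆ p ∈ closedBall (0 : E n) ε, (H x p 0 : EReal))
        (Bornology.cobounded (E n)) <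
      (⨆ x : E n, ⨅ p : E n, (H x p 0 : EReal)) ∧
    (⨆ x : E n, ⨅ p : E n, (H x p 0 : EReal)) < ⊤

/-- Differentiability in `u`, two-sided bounds on `∂ᵤH` for bounded `p`, and a modulus for the
difference quotient at `u = 0`. -/
structure AssumptionH3 {n : ℕ} (H : E n → E n → ℝ → ℝ) : Prop where
  differentiable : ∀ x p, Differentiable ℝ (H x p)
  bounds : ∀ R : ℝ, 0 < R → ∃ κ₁ κ₂ : ℝ, 0 < κ₁ ∧
    ∀ x p, ‖p‖ ≤ R → ∀ u, κ₁ ≤ deriv (H x p) u ∧ deriv (H x p) u ≤ κ₂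
  modulus : ∀ R : ℝ, 0 < R → ∃ ω : ℝ → ℝ, Tendsto ω (𝓝[>] 0) (𝓝 0) ∧
    ∀ x p, ‖x‖ ≤ R → ‖p‖ ≤ R → ∀ u, u ≠ 0 →
      |(H x p u - H x p 0) / u - deriv (H x p) 0| ≤ ω |u|

/-- Differentiability in `u` with a uniform upper bound on `∂ᵤH`. -/
def AssumptionH4 {n : ℕ} (H : E n → E n → ℝ → ℝ) : Prop :=
  (∀ x p, Differentiable ℝ (H x p)) ∧ ∃ κ : ℝ, ∀ x p u, deriv (H x p) u ≤ κ

def AssumptionP1 {n : ℕ} (H : E n → E n → ℝ → ℝ) : Prop :=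
  AssumptionH4 H ∧
  ∃ θ ∈ Ioo (0 : ℝ) 1, ∃ C : ℝ, 0 < C ∧ ∀ x p u, H x (θ • p) u ≤ H x p u + C

def AssumptionP2 {n : ℕ} (H : E n → E n → ℝ → ℝ) : Prop :=
  AssumptionH4 H ∧
  (∀ x, ConvexOn ℝ univ fun q : E n × ℝ => H x q.1 q.2) ∧
  ∃ θ ∈ Ioo (0 : ℝ) 1, ∀ C : ℝ, ∃ C' : ℝ, 0 < C' ∧
    ∀ x p u, H x p (θ * u) ≤ C → H x p u ≤ C'

structure AssumptionP3 {n : ℕ} (H : E n → E n → ℝ → ℝ) : Prop where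
  h3 : AssumptionH3 H
  bddAbove : ∀ R : ℝ, 0 < R → ∀ C : ℝ, 0 < C → ∃ M : ℝ,
    ∀ x p u, ‖p‖ ≤ R → |u| ≤ C → H x p u ≤ M
  bddBelow : ∀ u₀ : ℝ, ∃ m : ℝ, ∀ x p, m ≤ H x p u₀
  coercive : ∀ C : ℝ, 0 < C → ∀ M : ℝ, ∃ r : ℝ,
    ∀ x p u, r ≤ ‖p‖ → |u| ≤ C → M ≤ H x p u

end HJ

namespace HJ

variable {n : ℕ}

/-! ### Gradients -/

/-! Write `w` for the state-constraint solution in the ball of radius `R` and `u` for the maximal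
solution. The bound `u ≤ w` is comparison in the ball (`comparison_closedBall`), since `u` is a
subsolution there.

For `w z ≤ u z`, extend `w` to a global subsolution that agrees with it at `z`. Far out, momenta of
size at most `ε` are subcritical by a margin `δ`, so the concave cone `C - ε √(1 + |x|²)` is a
subsolution there once the discount `lam` is small enough for `lam * C` to cost at most `δ`. If `w`
lies below the cone on a ball containing `z` and above it near the boundary, then the minimum of the
two, continued by the cone, is a global subsolution (`SubAt.glue`). The reason is convexity in `p`,
through `SubAt.min_of_eq`. Perron's method makes the maximal solution dominate every continuous
subsolution (`exists_maximalSolution`), hence this one.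

For the radii and `lam` to depend on `z` alone, `w` needs bounds uniform in `R` and `lam`. From
below, `exists_discounted_subsolution` lowers bounded, almost critical subsolutions by a fixed
constant and compares. From above, `exists_le_one` shows that a `w` exceeding 1 on a whole fixed
ball would yield a global subsolution at a level below the critical value; a Lipschitz estimate then
propagates the bound from one point. -/

lemma HasGradientAt.add {f g : E n → ℝ} {p q x : E n} (hf : HasGradientAt f p x)
    (hg : HasGradientAt g q x) : HasGradientAt (fun y => f y + g y) (p + q) x := by
  rw [hasGradientAt_iff_hasFDerivAt] at *
  rw [map_add]
  exact hf.add hg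

lemma HasGradientAt.sub {f g : E n → ℝ} {p q x : E n} (hf : HasGradientAt f p x)
    (hg : HasGradientAt g q x) : HasGradientAt (fun y => f y - g y) (p - q) x := by
  rw [hasGradientAt_iff_hasFDerivAt] at *
  rw [map_sub]
  exact hf.sub hg

lemma HasGradientAt.scomp {f : E n → ℝ} {g : ℝ → ℝ} {g' : ℝ} {p x : E n}
    (hg : HasDerivAt g g' (f x)) (hf : HasGradientAt f p x) :
    HasGradientAt (fun y => g (f y)) (g' • p) x := by
  rw [hasGradientAt_iff_hasFDerivAt] at *
  rw [map_smul]
  exact hg.comp_hasFDerivAt x hf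

lemma hasGradientAt_inner_sub (q x₀ x : E n) :
    HasGradientAt (fun y => inner ℝ q (y - x₀)) q x := by
  rw [hasGradientAt_iff_hasFDerivAt]
  exact ((InnerProductSpace.toDual ℝ (E n) q).hasFDerivAt).comp x
    ((hasFDerivAt_id x).sub_const x₀)

lemma hasGradientAt_norm_sub_sq (a : ℝ) (x₀ x : E n) :
    HasGradientAt (fun y => a * ‖y - x₀‖ ^ 2) ((2 * a) • (x - x₀)) x := by
  rw [hasGradientAt_iff_hasFDerivAt]
  have h := (((hasFDerivAt_id x).sub_const x₀).norm_sq).const_mul a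
  refine h.congr_fderiv ?_
  ext v
  simp
  ring

lemma continuous_gradient {φ : E n → ℝ} (hφ : ContDiff ℝ 1 φ) : Continuous (gradient φ) :=
  (InnerProductSpace.toDual ℝ (E n)).symm.continuous.comp (hφ.continuous_fderiv one_ne_zero)

lemma hasGradientAt_gradient {φ : E n → ℝ} (hφ : ContDiff ℝ 1 φ) (x : E n) :
    HasGradientAt φ (gradient φ x) x :=
  (hφ.differentiable one_ne_zero x).hasGradientAt

lemma contDiff_norm_sub_sq (a : ℝ) (x₀ : E n) :
    ContDiff ℝ 1 (fun y : E n => a * ‖y - x₀‖ ^ 2) :=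
  contDiff_const.mul ((contDiff_id.sub contDiff_const).norm_sq ℝ)

/-! ### Pointwise subsolutions -/

/-- The viscosity subsolution inequality `F(x, Du, u) ≤ c` at a single point. -/
def SubAt (F : E n → E n → ℝ → ℝ) (c : ℝ) (u : E n → ℝ) (x : E n) : Prop :=
  ∀ φ : E n → ℝ, ContDiff ℝ 1 φ → IsLocalMax (fun y => u y - φ y) x →
    F x (gradient φ x) (u x) ≤ c

variable {F : E n → E n → ℝ → ℝ} {c : ℝ} {u v : E n → ℝ} {x : E n}

lemma isViscositySubsolution_iff {Ω : Set (E n)} (hΩ : IsOpen Ω) :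
    IsViscositySubsolution F c Ω u ↔ ∀ x ∈ Ω, SubAt F c u x := by
  refine ⟨fun h x hx φ hφ hm => h φ hφ x hx (hm.on Ω), fun h φ hφ x hx hm => h x hx φ hφ ?_⟩
  exact hm.isLocalMax (hΩ.mem_nhds hx)

lemma SubAt.congr (h : SubAt F c u x) (huv : v =ᶠ[𝓝 x] u) : SubAt F c v x := by
  intro φ hφ hm
  rw [huv.eq_of_nhds]
  refine h φ hφ ?_
  filter_upwards [hm, huv] with y hy hy'
  rwa [hy', huv.eq_of_nhds] at hy

lemma SubAt.max (hu : SubAt F c u x) (hv : SubAt F c v x) :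
    SubAt F c (fun y => max (u y) (v y)) x := by
  intro φ hφ hm
  rcases le_total (v x) (u x) with h | h
  · simp only [max_eq_left h]
    refine hu φ hφ ?_
    filter_upwards [hm] with y hy
    simp only [max_eq_left h] at hy
    linarith [le_max_left (u y) (v y)]
  · simp only [max_eq_right h]
    refine hv φ hφ ?_
    filter_upwards [hm] with y hy
    simp only [max_eq_right h] at hy
    linarith [le_max_right (u y) (v y)]

lemma SubAt.of_hasGradientAt {p : E n} (hu : HasGradientAt u p x) (h : F x p (u x) ≤ c) :
    SubAt F c u x := by
  intro φ hφ hm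
  have h1 := hm.hasFDerivAt_eq_zero
    ((hasGradientAt_iff_hasFDerivAt.1 (HasGradientAt.sub hu (hasGradientAt_gradient hφ x))))
  have h2 : p - gradient φ x = 0 := (LinearIsometryEquiv.map_eq_zero_iff _).1 h1
  rwa [← sub_eq_zero.1 h2]

/-- A subsolution lying below a test function on a sphere is touched inside the ball. -/
lemma exists_touching {θ : E n → ℝ} {x₀ : E n} {r : ℝ} (hr : 0 < r)
    (hsub : ∀ y ∈ ball x₀ r, SubAt F c v y) (hv : ContinuousOn v (closedBall x₀ r))
    (hθ : ContDiff ℝ 1 θ) (hb : ∀ y ∈ sphere x₀ r, v y - θ y < v x₀ - θ x₀) :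
    ∃ y ∈ ball x₀ r, F y (gradient θ y) (v y) ≤ c ∧ v x₀ - θ x₀ ≤ v y - θ y := by
  obtain ⟨y, hy, hmax⟩ := (isCompact_closedBall x₀ r).exists_isMaxOn
    ⟨x₀, mem_closedBall_self hr.le⟩ (hv.sub hθ.continuous.continuousOn)
  have h0 : v x₀ - θ x₀ ≤ v y - θ y := hmax (mem_closedBall_self hr.le)
  have hyb : y ∈ ball x₀ r := by
    rcases (mem_closedBall.1 hy).lt_or_eq with h | h
    · exact h
    · exact absurd h0 (not_le.2 (hb y h))
  refine ⟨y, hyb, hsub y hyb θ hθ ?_, h0⟩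
  filter_upwards [isOpen_ball.mem_nhds hyb] with z hz
  exact hmax (ball_subset_closedBall hz)

/-! ### Lipschitz estimates -/

/-- A cone of slope `L' > L` plus a quadratic penalty cannot touch `u` from above away from its
vertex, because its gradient there is longer than `L`. -/
lemma SubAt.local_growth {Ω : Set (E n)} (hΩ : IsOpen Ω) (hu : ContinuousOn u Ω)
    (hsub : ∀ x ∈ Ω, SubAt F c u x) {L L' : ℝ} (hL0 : 0 ≤ L) (hLL : L < L')
    (hL : ∀ x ∈ Ω, ∀ p, F x p (u x) ≤ c → ‖p‖ ≤ L) {x₀ : E n} (hx₀ : x₀ ∈ Ω) :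
    ∃ K r : ℝ, 0 < r ∧ ∀ y ∈ closedBall x₀ r, u y ≤ u x₀ + L' * ‖y - x₀‖ + K * ‖y - x₀‖ ^ 2 := by
  obtain ⟨r, hr, hrΩ⟩ := nhds_basis_closedBall.mem_iff.1 (hΩ.mem_nhds hx₀)
  have hne : (closedBall x₀ r).Nonempty := ⟨x₀, mem_closedBall_self hr.le⟩
  obtain ⟨m, hm, hmmax⟩ := (isCompact_closedBall x₀ r).exists_isMaxOn hne (hu.mono hrΩ)
  have hm0 : u x₀ ≤ u m := hmmax (mem_closedBall_self hr.le)
  -- On the sphere the penalty exceeds the largest increase of `u` by one, so the maximum is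
  -- attained in the open ball.
  set K : ℝ := (u m - u x₀ + 1) / r ^ 2 with hK
  have hKpos : 0 < K := by apply div_pos <;> [linarith; positivity]
  have hKr : K * r ^ 2 = u m - u x₀ + 1 := by rw [hK]; field_simp
  have hcont : ContinuousOn (fun y => u y - L' * ‖y - x₀‖ - K * ‖y - x₀‖ ^ 2) (closedBall x₀ r) := by
    refine ((hu.mono hrΩ).sub ?_).sub ?_ <;> fun_prop
  obtain ⟨y, hy, hymax⟩ := (isCompact_closedBall x₀ r).exists_isMaxOn hne hcont
  refine ⟨K, r, hr, fun z hz => ?_⟩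
  have hz' := hymax hz
  have hx' := hymax (mem_closedBall_self hr.le)
  simp only [mem_ofPred_eq, sub_self, norm_zero, mul_zero, ne_eq, OfNat.ofNat_ne_zero,
    not_false_eq_true, zero_pow, sub_zero] at hz' hx'
  suffices hyx : y = x₀ by
    subst hyx
    simp at hz'
    linarith
  by_contra hyx
  have hρ : 0 < ‖y - x₀‖ := norm_pos_iff.2 (sub_ne_zero.2 hyx)
  set ρ := ‖y - x₀‖ with hρdef
  have hyr : ρ < r := by
    rcases (mem_closedBall_iff_norm.1 hy).lt_or_eq with h | h
    · exact h
    · exfalso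
      have h1 : u y ≤ u m := hmmax hy
      rw [← hρdef] at h
      rw [h] at hx'
      have : 0 < L' * r := mul_pos (by linarith) hr
      linarith
  have hyΩ := hrΩ hy
  -- The norm is replaced by the paraboloid that touches it from above at radius `ρ`. The test
  -- function is then smooth everywhere, with gradient of norm `L' + 2 * K * ρ` at `y`.
  set a : ℝ := L' / (2 * ρ) + K with ha
  have htest : F y ((2 * a) • (y - x₀)) (u y) ≤ c := by
    have h := hsub y hyΩ _ (contDiff_norm_sub_sq a x₀) ?_
    · rwa [(hasGradientAt_norm_sub_sq a x₀ y).gradient] at h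
    · filter_upwards [isOpen_ball.mem_nhds (mem_ball_iff_norm.2 hyr)] with z hz
      have hz' := hymax (ball_subset_closedBall hz)
      simp only [mem_ofPred_eq] at hz'
      have h1 : L' * ‖z - x₀‖ ≤ L' / (2 * ρ) * ‖z - x₀‖ ^ 2 + L' * ρ / 2 := by
        have : L' / (2 * ρ) * ‖z - x₀‖ ^ 2 + L' * ρ / 2 - L' * ‖z - x₀‖
            = L' / (2 * ρ) * (‖z - x₀‖ - ρ) ^ 2 := by field_simp; ring
        have h3 : 0 ≤ L' / (2 * ρ) * (‖z - x₀‖ - ρ) ^ 2 :=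
          mul_nonneg (div_nonneg (by linarith) (by positivity)) (sq_nonneg _)
        linarith
      have h2 : L' / (2 * ρ) * ρ ^ 2 = L' * ρ / 2 := by field_simp
      rw [← hρdef] at hz' ⊢
      rw [ha, add_mul, add_mul]
      linarith
  have h1 := hL y hyΩ _ htest
  have ha0 : 0 < 2 * a := by
    have : 0 < L' / (2 * ρ) := div_pos (by linarith) (by positivity)
    linarith
  rw [norm_smul, Real.norm_eq_abs, abs_of_pos ha0, ← hρdef, ha] at h1
  have h2 : 2 * (L' / (2 * ρ) + K) * ρ = L' + 2 * K * ρ := by field_simp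
  nlinarith

/-- A continuous subsolution on a convex open set whose admissible gradients are bounded by `L`
is `L`-Lipschitz. -/
lemma SubAt.sub_le {Ω : Set (E n)} (hΩ : IsOpen Ω) (hconv : Convex ℝ Ω) (hu : ContinuousOn u Ω)
    (hsub : ∀ x ∈ Ω, SubAt F c u x) {L : ℝ} (hL0 : 0 ≤ L)
    (hL : ∀ x ∈ Ω, ∀ p, F x p (u x) ≤ c → ‖p‖ ≤ L) {x y : E n} (hx : x ∈ Ω) (hy : y ∈ Ω) :
    u y - u x ≤ L * ‖y - x‖ := by
  set d := ‖y - x‖ with hd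
  have hd0 : 0 ≤ d := norm_nonneg _
  have hmem : ∀ t ∈ Icc (0 : ℝ) 1, x + t • (y - x) ∈ Ω := fun t ht =>
    hconv.add_smul_sub_mem hx hy ht
  -- Along the segment, local growth bounds the right slopes by every number above `L * d`; a
  -- one-sided mean value inequality concludes.
  have key := image_le_of_liminf_slope_right_le_deriv_boundary (a := 0) (b := 1)
    (f := fun t : ℝ => u (x + t • (y - x))) (B := fun t => u x + L * d * t)
    (B' := fun _ => L * d) ?_ (by simp) (by fun_prop) ?_ ?_ (right_mem_Icc.2 zero_le_one)
  · simp at key; linarith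
  · exact hu.comp (by fun_prop) hmem
  · intro t _
    simpa using (((hasDerivAt_id t).const_mul (L * d)).const_add (u x)).hasDerivWithinAt
  · intro t ht r hr
    set L' := L + (r - L * d) / (2 * (d + 1)) with hL'
    have hpos : 0 < (r - L * d) / (2 * (d + 1)) := div_pos (by linarith) (by positivity)
    have hL'd : L' * d < r := by
      have h1 : (r - L * d) / (2 * (d + 1)) * (2 * (d + 1)) = r - L * d := by field_simp
      rw [hL']
      nlinarith
    obtain ⟨K, ρ, hρ, hK⟩ := SubAt.local_growth hΩ hu hsub hL0 (L' := L') (by linarith) hL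
      (hmem t ⟨ht.1, ht.2.le⟩)
    apply Eventually.frequently
    have hc : Tendsto (fun z : ℝ => L' * d + K * d ^ 2 * (z - t)) (𝓝[>] t) (𝓝 (L' * d)) := by
      have : ContinuousAt (fun z : ℝ => L' * d + K * d ^ 2 * (z - t)) t := by fun_prop
      have h2 := this.tendsto
      simp only [sub_self, mul_zero, add_zero] at h2
      exact h2.mono_left nhdsWithin_le_nhds
    have hc2 : Tendsto (fun z : ℝ => (z - t) * d) (𝓝[>] t) (𝓝 0) := by
      have : ContinuousAt (fun z : ℝ => (z - t) * d) t := by fun_prop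
      have h2 := this.tendsto
      simp only [sub_self, zero_mul] at h2
      exact h2.mono_left nhdsWithin_le_nhds
    filter_upwards [hc.eventually (gt_mem_nhds hL'd), hc2.eventually (gt_mem_nhds hρ),
      self_mem_nhdsWithin] with z hz1 hz2 hz3
    have hz3' : 0 < z - t := sub_pos.2 hz3
    have hdiff : (x + z • (y - x)) - (x + t • (y - x)) = (z - t) • (y - x) := by
      rw [sub_smul]; abel
    have hnorm : ‖(x + z • (y - x)) - (x + t • (y - x))‖ = (z - t) * d := by
      rw [hdiff, norm_smul, Real.norm_eq_abs, abs_of_pos hz3']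
    have h := hK (x + z • (y - x)) (by rw [mem_closedBall_iff_norm, hnorm]; exact hz2.le)
    rw [hnorm] at h
    rw [slope_def_field]
    refine lt_of_le_of_lt ?_ hz1
    rw [div_le_iff₀ hz3']
    nlinarith

lemma lipschitzOnWith_of_sub_le {S : Set (E n)} {L : ℝ}
    (h : ∀ y ∈ S, ∀ z ∈ S, u y - u z ≤ L * ‖y - z‖) :
    LipschitzOnWith (Real.toNNReal |L|) u S := by
  apply LipschitzOnWith.of_dist_le_mul
  intro y hy z hz
  rw [Real.dist_eq, dist_eq_norm, Real.coe_toNNReal _ (abs_nonneg _), abs_le]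
  have h1 := h y hy z hz
  have h2 := h z hz y hy
  rw [norm_sub_rev] at h2
  have h4 := mul_le_mul_of_nonneg_right (le_abs_self L) (norm_nonneg (y - z))
  constructor <;> linarith

/-! ### Stability under suprema -/

/-- Adding `|y - x₀|²` to the test function makes the maximum strict, so a nearly optimal member of
`V` is touched close to `x₀`. Monotonicity in the value absorbs the fact that this member may be
large at the touching point. -/
lemma SubAt.of_approx (hFc : Continuous fun q : E n × E n × ℝ => F q.1 q.2.1 q.2.2)
    (hFm : ∀ x p, Monotone (F x p)) {x₀ : E n} {ρ : ℝ} (hρ : 0 < ρ) (V : Set (E n → ℝ))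
    (hsub : ∀ v ∈ V, ∀ y ∈ ball x₀ ρ, SubAt F c v y) (hcont : ∀ v ∈ V, ContinuousOn v (ball x₀ ρ))
    (hle : ∀ v ∈ V, ∀ y ∈ ball x₀ ρ, v y ≤ u y)
    (happrox : ∀ η > 0, ∃ v ∈ V, u x₀ - η < v x₀) : SubAt F c u x₀ := by
  intro φ hφ hm
  by_contra! hlt
  obtain ⟨ρ₁, hρ₁, hm'⟩ := Metric.eventually_nhds_iff_ball.1 hm
  have hθc : ContDiff ℝ 1 (fun y => φ y + 1 * ‖y - x₀‖ ^ 2) := hφ.add (contDiff_norm_sub_sq 1 x₀)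
  have hθg : ∀ y, gradient (fun y => φ y + 1 * ‖y - x₀‖ ^ 2) y
      = gradient φ y + (2 * (1 : ℝ)) • (y - x₀) := fun y =>
    (HasGradientAt.add (hasGradientAt_gradient hφ y) (hasGradientAt_norm_sub_sq 1 x₀ y)).gradient
  have hG : Continuous (fun q : E n × ℝ =>
      F q.1 (gradient φ q.1 + (2 * (1 : ℝ)) • (q.1 - x₀)) (φ q.1 + 1 * ‖q.1 - x₀‖ ^ 2 + q.2)) := by
    have h1 := (continuous_gradient hφ).comp (continuous_fst (X := E n) (Y := ℝ))
    have h2 := hφ.continuous.comp (continuous_fst (X := E n) (Y := ℝ))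
    refine hFc.comp (continuous_fst.prodMk ((h1.add ?_).prodMk ((h2.add ?_).add continuous_snd)))
    all_goals fun_prop
  have hG0 := hG.continuousAt (x := (x₀, u x₀ - φ x₀))
  have hev := hG0.eventually (lt_mem_nhds (a := c) (by simpa using hlt))
  obtain ⟨r₀, hr₀, hball⟩ := Metric.eventually_nhds_iff_ball.1 hev
  obtain ⟨r, hr, hrlt⟩ := exists_between (lt_min hρ (lt_min hρ₁ hr₀))
  have hrρ : r < ρ := hrlt.trans_le (min_le_left _ _)
  have hrρ₁ : r < ρ₁ := hrlt.trans_le ((min_le_right _ _).trans (min_le_left _ _))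
  have hrr₀ : r < r₀ := hrlt.trans_le ((min_le_right _ _).trans (min_le_right _ _))
  obtain ⟨v, hvV, hv⟩ := happrox (min (r ^ 2) r₀) (lt_min (by positivity) hr₀)
  have hv1 : u x₀ - r ^ 2 < v x₀ := by linarith [min_le_left (r ^ 2) r₀]
  have hv2 : u x₀ - r₀ < v x₀ := by linarith [min_le_right (r ^ 2) r₀]
  have hvu := hle v hvV x₀ (mem_ball_self hρ)
  obtain ⟨y, hy, hFy, hval⟩ := exists_touching (F := F) (c := c) (v := v) hr
    (fun y hy => hsub v hvV y (ball_subset_ball hrρ.le hy))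
    ((hcont v hvV).mono (closedBall_subset_ball hrρ)) hθc (by
      intro y hy
      have hyn : ‖y - x₀‖ = r := mem_sphere_iff_norm.1 hy
      have h1 := hm' y (by rw [mem_ball_iff_norm, hyn]; exact hrρ₁)
      have h2 := hle v hvV y (by rw [mem_ball_iff_norm, hyn]; exact hrρ)
      simp only [hyn, sub_self, norm_zero]
      simp only at h1
      linarith)
  have h3 := hball (y, v x₀ - φ x₀) (by
    rw [mem_ball, Prod.dist_eq]
    refine max_lt ((mem_ball.1 hy).trans hrr₀) ?_
    rw [Real.dist_eq, abs_lt]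
    constructor <;> simp only <;> linarith)
  simp only at h3
  rw [hθg] at hFy
  refine absurd hFy (not_le.2 (h3.trans_le (hFm _ _ ?_)))
  simp only [sub_self, norm_zero] at hval
  linarith

/-! ### The minimum of a subsolution and a smooth subsolution -/

/-- The test function `⟪q, y - x₀⟫ + m (exp (k ⟪q, y - x₀⟫) - 1) + a |y - x₀|²`. -/
noncomputable def barrier (q x₀ : E n) (m k a : ℝ) (y : E n) : ℝ :=
  inner ℝ q (y - x₀) + m * (Real.exp (k * inner ℝ q (y - x₀)) - 1) + a * ‖y - x₀‖ ^ 2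

lemma contDiff_barrier (q x₀ : E n) (m k a : ℝ) : ContDiff ℝ 1 (barrier q x₀ m k a) := by
  have h1 : ContDiff ℝ 1 (fun y : E n => inner ℝ q (y - x₀)) :=
    contDiff_const.inner ℝ (contDiff_id.sub contDiff_const)
  exact (h1.add (contDiff_const.mul ((Real.contDiff_exp.comp (contDiff_const.mul h1)).sub
    contDiff_const))).add (contDiff_norm_sub_sq _ _)

lemma hasGradientAt_barrier (q x₀ : E n) (m k a : ℝ) (y : E n) :
    HasGradientAt (barrier q x₀ m k a)
      (q + (m * (k * Real.exp (k * inner ℝ q (y - x₀)))) • q + (2 * a) • (y - x₀)) y := by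
  have hd : ∀ t : ℝ, HasDerivAt (fun t : ℝ => m * (Real.exp (k * t) - 1))
      (m * (k * Real.exp (k * t))) t := by
    intro t
    have := ((((hasDerivAt_id t).const_mul k).exp).sub_const 1).const_mul m
    exact this.congr_deriv (by simp only [id]; ring)
  exact HasGradientAt.add (HasGradientAt.add (hasGradientAt_inner_sub q x₀ y)
    (HasGradientAt.scomp (g := fun t : ℝ => m * (Real.exp (k * t) - 1)) (hd _)
      (hasGradientAt_inner_sub q x₀ y))) (hasGradientAt_norm_sub_sq _ _ _)

/-- Where the linear part of `χ` is clearly negative, the minimum is `w` itself and `χ` bounds it.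
Elsewhere only the Lipschitz bound is available, starting from the region where `w ≤ 0`; the
exponential term dominates the resulting linear growth. -/
lemma min_barrier {w χ : E n → ℝ} {x₀ q : E n} {ρ Λ η : ℝ} (hρ : 0 < ρ) (hΛ : 0 ≤ Λ)
    (hw : ∀ y ∈ ball x₀ ρ, ∀ z ∈ ball x₀ ρ, w y - w z ≤ Λ * ‖y - z‖)
    (hχ : HasGradientAt χ q x₀) (hχ0 : χ x₀ = 0)
    (hle : ∀ y ∈ ball x₀ ρ, min (w y) 0 ≤ χ y) (hq : q ≠ 0) (hη : 0 < η) (hηq : 3 * η ≤ ‖q‖) :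
    ∃ r₀ > 0, ∀ r ∈ Ioo 0 r₀, ∀ y ∈ sphere x₀ r,
      w y < inner ℝ q (y - x₀)
        + η * r * (Real.exp (Λ / (‖q‖ * (η * r)) * inner ℝ q (y - x₀)) - 1)
        + (3 + 3 * Λ / ‖q‖) * (η * r) := by
  have hQ : 0 < ‖q‖ := norm_pos_iff.2 hq
  have hlin := (hasGradientAt_iff_isLittleO.1 hχ).def (c := η / 3) (by positivity)
  obtain ⟨r₁, hr₁, hlin⟩ := Metric.eventually_nhds_iff_ball.1 hlin
  refine ⟨min ρ r₁ / 3, by positivity, fun r hr y hy => ?_⟩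
  obtain ⟨hr0, hr3⟩ := hr
  have h3ρ : 3 * r < ρ := by linarith [min_le_left ρ r₁]
  have h3r₁ : 3 * r < r₁ := by linarith [min_le_right ρ r₁]
  have hyn : ‖y - x₀‖ = r := mem_sphere_iff_norm.1 hy
  have hest : ∀ z, ‖z - x₀‖ ≤ 3 * r → χ z ≤ inner ℝ q (z - x₀) + η * r := by
    intro z hz
    have h := hlin z (by rw [mem_ball_iff_norm]; linarith)
    rw [hχ0, sub_zero, Real.norm_eq_abs] at h
    have h' := (abs_le.1 h).2
    nlinarith
  have hηr : 0 < η * r := by positivity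
  set S := inner ℝ q (y - x₀) with hS
  have hexp := Real.exp_pos (Λ / (‖q‖ * (η * r)) * S)
  have hC : 0 ≤ 3 * Λ / ‖q‖ := by positivity
  have hyρ : y ∈ ball x₀ ρ := by rw [mem_ball_iff_norm, hyn]; linarith
  rcases lt_or_ge (S + η * r) 0 with hneg | hpos
  · have h1 := hest y (by linarith)
    have h2 := hle y hyρ
    have h3 : w y ≤ S + η * r := by
      rcases min_le_iff.1 (h2.trans h1) with h | h
      · exact h
      · linarith
    nlinarith
  -- Going back a distance `τ` along `q` reaches a point where the linear part is `-3 * η * r`, so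
  -- that `χ < 0` and hence `w ≤ 0`.
  · set τ : ℝ := (S + 3 * (η * r)) / ‖q‖ with hτ
    have hτ0 : 0 ≤ τ := div_nonneg (by linarith) hQ.le
    set z := y - (τ / ‖q‖) • q with hz
    have hyz : ‖y - z‖ = τ := by
      rw [hz, sub_sub_cancel, norm_smul, Real.norm_eq_abs, abs_of_nonneg (by positivity)]
      field_simp
    have hSQ : S ≤ ‖q‖ * r := by
      rw [hS, ← hyn]; exact real_inner_le_norm _ _
    have hτr : τ ≤ 2 * r := by
      rw [hτ, div_le_iff₀ hQ]
      nlinarith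
    have hz3 : ‖z - x₀‖ ≤ 3 * r := by
      have : z - x₀ = (y - x₀) - (y - z) := by abel
      rw [this]
      refine (norm_sub_le _ _).trans ?_
      rw [hyn, hyz]; linarith
    have hSz : inner ℝ q (z - x₀) = - (3 * (η * r)) := by
      have : z - x₀ = (y - x₀) - (τ / ‖q‖) • q := by rw [hz]; abel
      rw [this, inner_sub_right, inner_smul_right, real_inner_self_eq_norm_sq, ← hS, hτ]
      field_simp
      ring
    have hzρ : z ∈ ball x₀ ρ := by rw [mem_ball_iff_norm]; linarith
    have h1 := hest z hz3
    rw [hSz] at h1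
    have hwz : w z ≤ 0 := by
      rcases min_le_iff.1 ((hle z hzρ).trans h1) with h | h <;> linarith
    have h2 := hw y hyρ z hzρ
    rw [hyz] at h2
    have h3 : Λ * τ = Λ / ‖q‖ * S + 3 * Λ / ‖q‖ * (η * r) := by
      rw [hτ]; field_simp
    have h4 := Real.add_one_le_exp (Λ / (‖q‖ * (η * r)) * S)
    have h5 : η * r * (Λ / (‖q‖ * (η * r)) * S) = Λ / ‖q‖ * S := by field_simp
    have h6 := mul_le_mul_of_nonneg_left h4 hηr.le
    rw [mul_add, h5] at h6
    linarith

/-- If `φ` touches `min u ψ` from above at a point where `u = ψ`, then near this point `u` has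
supergradients close to the ray from `Dψ` through `Dφ`, beyond `Dφ`. -/
lemma SubAt.exists_touching_min {x₀ : E n} {ρ L δ : ℝ} (hρ : 0 < ρ) (hδ : 0 < δ)
    (hsub : ∀ y ∈ ball x₀ ρ, SubAt F c u y)
    (hlip : ∀ y ∈ ball x₀ ρ, ∀ z ∈ ball x₀ ρ, u y - u z ≤ L * ‖y - z‖)
    {ψ φ : E n → ℝ} (hψ : ContDiff ℝ 1 ψ) (heq : u x₀ = ψ x₀) (hφ : ContDiff ℝ 1 φ)
    (hm : IsLocalMax (fun y => min (u y) (ψ y) - φ y) x₀)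
    {q : E n} (hqdef : q = gradient φ x₀ - gradient ψ x₀) (hq : q ≠ 0) :
    ∃ y ∈ ball x₀ δ, ∃ t : ℝ, 0 ≤ t ∧ ∃ e : E n, ‖e‖ < δ ∧
      F y (gradient ψ y + (q + t • q + e)) (u y) ≤ c := by
  have hQ : 0 < ‖q‖ := norm_pos_iff.2 hq
  obtain ⟨Kψ, s, hs, hKψ⟩ := hψ.contDiffAt.exists_lipschitzOnWith (x := x₀)
  obtain ⟨ρ₁, hρ₁, hball₁⟩ := Metric.mem_nhds_iff.1 hs
  obtain ⟨ρ₂, hρ₂, hm'⟩ := Metric.eventually_nhds_iff_ball.1 hm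
  obtain ⟨ρ', hρ'0, hρ'lt⟩ := exists_between (lt_min hρ (lt_min hρ₁ hρ₂))
  have hρ'ρ : ρ' ≤ ρ := hρ'lt.le.trans (min_le_left _ _)
  have hρ'ρ₁ : ρ' ≤ ρ₁ := hρ'lt.le.trans ((min_le_right _ _).trans (min_le_left _ _))
  have hρ'ρ₂ : ρ' ≤ ρ₂ := hρ'lt.le.trans ((min_le_right _ _).trans (min_le_right _ _))
  obtain ⟨Λ, hΛ⟩ : ∃ Λ : ℝ, Λ = |L| + Kψ := ⟨_, rfl⟩
  have hΛ0 : 0 ≤ Λ := by rw [hΛ]; positivity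
  have hwlip : ∀ y ∈ ball x₀ ρ', ∀ z ∈ ball x₀ ρ', (u y - ψ y) - (u z - ψ z) ≤ Λ * ‖y - z‖ := by
    intro y hy z hz
    have h1 := hlip y (ball_subset_ball hρ'ρ hy) z (ball_subset_ball hρ'ρ hz)
    have h2 := hKψ.dist_le_mul y (hball₁ (ball_subset_ball hρ'ρ₁ hy)) z
      (hball₁ (ball_subset_ball hρ'ρ₁ hz))
    rw [Real.dist_eq, dist_eq_norm] at h2
    have h3 := (abs_le.1 h2).1
    have h4 := mul_le_mul_of_nonneg_right (le_abs_self L) (norm_nonneg (y - z))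
    rw [hΛ, add_mul]
    linarith
  have hχg : HasGradientAt (fun y => (φ y - ψ y) - (φ x₀ - ψ x₀)) q x₀ := by
    have := HasGradientAt.sub (HasGradientAt.sub (hasGradientAt_gradient hφ x₀)
      (hasGradientAt_gradient hψ x₀)) (hasGradientAt_const x₀ (φ x₀ - ψ x₀))
    rwa [sub_zero, ← hqdef] at this
  have hle : ∀ y ∈ ball x₀ ρ', min (u y - ψ y) 0 ≤ (φ y - ψ y) - (φ x₀ - ψ x₀) := by
    intro y hy
    have h := hm' y (ball_subset_ball hρ'ρ₂ hy)
    simp only [heq, min_self] at h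
    have h2 : min (u y - ψ y) 0 = min (u y) (ψ y) - ψ y := by
      rw [← min_sub_sub_right, sub_self]
    rw [h2]
    linarith
  obtain ⟨N, hN⟩ : ∃ N : ℝ, N = 3 + 3 * Λ / ‖q‖ := ⟨_, rfl⟩
  have hN0 : 0 < N := by rw [hN]; positivity
  obtain ⟨η, hη, hηlt⟩ := exists_between
    (lt_min (a := (0 : ℝ)) (b := ‖q‖ / 3) (c := δ / (4 * N)) (by positivity) (by positivity))
  have hηq : 3 * η ≤ ‖q‖ := by linarith [min_le_left (‖q‖ / 3) (δ / (4 * N))]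
  have hηN : 2 * N * η < δ := by
    have h1 : η ≤ δ / (4 * N) := hηlt.le.trans (min_le_right _ _)
    rw [le_div_iff₀ (by positivity)] at h1
    linarith
  obtain ⟨r₀, hr₀, hbar⟩ := min_barrier (w := fun y => u y - ψ y) hρ'0 hΛ0 hwlip hχg
    (sub_self _) hle hq hη hηq
  obtain ⟨r, hr, hrlt⟩ := exists_between (lt_min hr₀ (lt_min hρ'0 hδ))
  have hrr₀ : r < r₀ := hrlt.trans_le (min_le_left _ _)
  have hrρ' : r < ρ' := hrlt.trans_le ((min_le_right _ _).trans (min_le_left _ _))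
  have hrδ : r < δ := hrlt.trans_le ((min_le_right _ _).trans (min_le_right _ _))
  have hucont : ContinuousOn u (closedBall x₀ r) :=
    (lipschitzOnWith_of_sub_le hlip).continuousOn.mono
      (closedBall_subset_ball (hrρ'.trans_le hρ'ρ))
  -- The exponential is increasing along `q`, so it only adds a nonnegative multiple of `q` to the
  -- gradient. The quadratic term supplies the margin `N * η * r` on the sphere, while its gradient
  -- stays below `2 * N * η < δ`.
  obtain ⟨y, hy, hFy, -⟩ := exists_touching (F := F) (c := c) (v := u)
    (θ := fun y => ψ y + barrier q x₀ (η * r) (Λ / (‖q‖ * (η * r))) (N * η / r) y) hr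
    (fun y hy => hsub y (ball_subset_ball (hrρ'.le.trans hρ'ρ) hy)) hucont
    (hψ.add (contDiff_barrier _ _ _ _ _)) (by
      intro y hy
      have h := hbar r ⟨hr, hrr₀⟩ y hy
      have hyn : ‖y - x₀‖ = r := mem_sphere_iff_norm.1 hy
      have h2 : N * η / r * r ^ 2 = N * (η * r) := by field_simp
      have h3 : barrier q x₀ (η * r) (Λ / (‖q‖ * (η * r))) (N * η / r) x₀ = 0 := by simp [barrier]
      rw [h3, barrier, hyn, h2, heq, hN]
      linarith)
  rw [(HasGradientAt.add (hasGradientAt_gradient hψ y)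
    (hasGradientAt_barrier _ _ _ _ _ y)).gradient] at hFy
  have hyr : ‖y - x₀‖ < r := mem_ball_iff_norm.1 hy
  refine ⟨y, ball_subset_ball hrδ.le hy, _, by positivity, _, ?_, hFy⟩
  rw [norm_smul, Real.norm_eq_abs, abs_of_pos (by positivity)]
  have h1 : 2 * (N * η / r) * ‖y - x₀‖ ≤ 2 * (N * η / r) * r :=
    mul_le_mul_of_nonneg_left hyr.le (by positivity)
  have h2 : 2 * (N * η / r) * r = 2 * N * η := by field_simp
  linarith

/-- Up to a small error, `Dφ` lies on the segment from `Dψ` to a supergradient of `u` at a nearby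
point. The Hamiltonian is at most about `c` at both ends, hence, by convexity, also at `Dφ`. -/
lemma SubAt.min_of_eq (hFc : Continuous fun q : E n × E n × ℝ => F q.1 q.2.1 q.2.2)
    (hFconv : ∀ x r, ConvexOn ℝ univ fun p => F x p r)
    {x₀ : E n} {ρ L : ℝ} (hρ : 0 < ρ) (hsub : ∀ y ∈ ball x₀ ρ, SubAt F c u y)
    (hlip : ∀ y ∈ ball x₀ ρ, ∀ z ∈ ball x₀ ρ, u y - u z ≤ L * ‖y - z‖)
    {ψ : E n → ℝ} (hψ : ContDiff ℝ 1 ψ) (hψF : F x₀ (gradient ψ x₀) (ψ x₀) ≤ c)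
    (heq : u x₀ = ψ x₀) : SubAt F c (fun y => min (u y) (ψ y)) x₀ := by
  intro φ hφ hm
  simp only [heq, min_self]
  obtain ⟨q, hqdef⟩ : ∃ q, q = gradient φ x₀ - gradient ψ x₀ := ⟨_, rfl⟩
  by_cases hq : q = 0
  · rw [hq] at hqdef
    rwa [sub_eq_zero.1 hqdef.symm]
  by_contra! hlt
  obtain ⟨c₁, hc₁, hc₁'⟩ := exists_between hlt
  have hu : ContinuousAt u x₀ :=
    (lipschitzOnWith_of_sub_le hlip).continuousOn.continuousAt (ball_mem_nhds _ hρ)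
  have hG1 : ContinuousAt (fun y => F y (gradient ψ y) (u y)) x₀ :=
    ContinuousAt.comp (f := fun y => (y, gradient ψ y, u y)) hFc.continuousAt
      (continuousAt_id.prodMk ((continuous_gradient hψ).continuousAt.prodMk hu))
  have hG2 : ContinuousAt (fun z : E n × E n =>
      F z.1 (gradient ψ z.1 + q + z.2) (u z.1)) (x₀, 0) := by
    refine ContinuousAt.comp (f := fun z : E n × E n => (z.1, gradient ψ z.1 + q + z.2, u z.1))
      hFc.continuousAt (continuousAt_fst.prodMk (ContinuousAt.prodMk ?_ ?_))
    · exact (((continuous_gradient hψ).comp continuous_fst).add continuous_const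
        |>.add continuous_snd).continuousAt
    · exact ContinuousAt.comp (f := Prod.fst) hu continuousAt_fst
  have hev1 := hG1.tendsto.eventually_lt_const (u := c₁) (by rw [heq]; linarith)
  have hev2 := hG2.tendsto.eventually_const_lt (u := c₁) (by
    simp only [heq, add_zero]
    rwa [hqdef, add_sub_cancel])
  obtain ⟨δ₁, hδ₁, hev1⟩ := Metric.eventually_nhds_iff_ball.1 hev1
  obtain ⟨δ₂, hδ₂, hev2⟩ := Metric.eventually_nhds_iff_ball.1 hev2
  obtain ⟨y, hy, t, ht0, e, hen, hFy⟩ := SubAt.exists_touching_min hρ (lt_min hδ₁ hδ₂) hsub hlip hψ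
    heq hφ hm hqdef hq
  -- This weight brings `(1 + t) • q` back to `q` and does not enlarge the error `e`, however large
  -- `t` is.
  obtain ⟨β, hβ⟩ : ∃ β : ℝ, β = 1 / (1 + t) := ⟨_, rfl⟩
  have hβ0 : 0 ≤ β := by rw [hβ]; positivity
  have hβ1 : β ≤ 1 := by rw [hβ, div_le_one (by positivity)]; linarith
  have hβt : β * (1 + t) = 1 := by rw [hβ]; field_simp
  have h1 := hev1 y (ball_subset_ball (min_le_left _ _) hy)
  have hconvx := (hFconv y (u y)).2 (mem_univ (gradient ψ y))
    (mem_univ (gradient ψ y + (q + t • q + e))) (sub_nonneg.2 hβ1) hβ0 (by ring)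
  have hpt : (1 - β) • gradient ψ y + β • (gradient ψ y + (q + t • q + e))
      = gradient ψ y + q + β • e := by
    have : q + t • q = (1 + t) • q := by rw [add_smul, one_smul]
    rw [this, smul_add, smul_add, smul_smul, hβt, sub_smul, one_smul, one_smul]
    abel
  have h2 := hev2 (y, β • e) (by
    rw [mem_ball, Prod.dist_eq]
    refine max_lt (ball_subset_ball (min_le_right _ _) hy) ?_
    rw [dist_zero_right, norm_smul, Real.norm_eq_abs, abs_of_nonneg hβ0]
    have h3 := mul_le_mul_of_nonneg_right hβ1 (norm_nonneg e)
    have h4 := min_le_right δ₁ δ₂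
    linarith)
  simp only [hpt, smul_eq_mul] at hconvx
  simp only at h1 h2
  have h5 := mul_le_mul_of_nonneg_left h1.le (sub_nonneg.2 hβ1)
  have h6 := mul_le_mul_of_nonneg_left (hFy.trans hc₁.le) hβ0
  linarith

/-- Continuous Hamiltonians, nondecreasing in `u`, convex and locally coercive in `p`. -/
structure Regular (F : E n → E n → ℝ → ℝ) : Prop where
  continuous : Continuous fun q : E n × E n × ℝ => F q.1 q.2.1 q.2.2
  monotone : ∀ x p, Monotone (F x p)
  convex : ∀ x r, ConvexOn ℝ univ fun p => F x p r
  coercive : ∀ R b M : ℝ, ∃ L, 0 ≤ L ∧ ∀ x, ‖x‖ ≤ R → ∀ p, F x p b ≤ M → ‖p‖ ≤ L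

/-- Coercivity at the single value `b` suffices: by monotonicity, a gradient admissible at a larger
value is admissible at `b`. Thus a lower bound on a subsolution already controls its Lipschitz
constant. -/
lemma Regular.exists_lipschitz_const (hF : Regular F) (R b c : ℝ) :
    ∃ L, 0 ≤ L ∧ ∀ Ω : Set (E n), IsOpen Ω → Convex ℝ Ω → (∀ x ∈ Ω, ‖x‖ ≤ R) →
      ∀ u : E n → ℝ, ContinuousOn u Ω → (∀ x ∈ Ω, SubAt F c u x) → (∀ x ∈ Ω, b ≤ u x) →
        ∀ y ∈ Ω, ∀ x ∈ Ω, u y - u x ≤ L * ‖y - x‖ := by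
  obtain ⟨L, hL0, hL⟩ := hF.coercive R b c
  refine ⟨L, hL0, fun Ω hΩ hconv hR u hu hsub hb y hy x hx => ?_⟩
  exact SubAt.sub_le hΩ hconv hu hsub hL0
    (fun x hx p hp => hL x (hR x hx) p ((hF.monotone x p (hb x hx)).trans hp)) hx hy

lemma Regular.lipschitz_closedBall (hF : Regular F) (R b c : ℝ) (hR : 0 < R) :
    ∃ L, 0 ≤ L ∧ ∀ u : E n → ℝ, ContinuousOn u (closedBall 0 R) →
      (∀ x ∈ ball (0 : E n) R, SubAt F c u x) → (∀ x ∈ ball (0 : E n) R, b ≤ u x) →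
        ∀ y ∈ closedBall (0 : E n) R, ∀ x ∈ closedBall (0 : E n) R, u y - u x ≤ L * ‖y - x‖ := by
  obtain ⟨L, hL0, hL⟩ := hF.exists_lipschitz_const R b c
  refine ⟨L, hL0, fun u hu hsub hb y hy x hx => ?_⟩
  have h := lipschitzOnWith_of_sub_le (hL (ball 0 R) isOpen_ball (convex_ball 0 R)
    (fun x hx => (mem_ball_zero_iff.1 hx).le) u (hu.mono ball_subset_closedBall) hsub hb)
  have h2 := LipschitzOnWith.closure (by rwa [closure_ball 0 hR.ne']) h
  rw [closure_ball 0 hR.ne'] at h2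
  have h3 := h2.dist_le_mul y hy x hx
  rw [Real.dist_eq, dist_eq_norm, Real.coe_toNNReal _ (abs_nonneg _), abs_of_nonneg hL0] at h3
  exact (abs_le.1 h3).2

lemma SubAt.min_smooth (hF : Regular F) {Ω : Set (E n)} (hΩ : IsOpen Ω) (hx : x ∈ Ω)
    (hsub : ∀ y ∈ Ω, SubAt F c u y) (hu : ContinuousOn u Ω)
    {ψ : E n → ℝ} (hψ : ContDiff ℝ 1 ψ) (hψF : ψ x ≤ u x → F x (gradient ψ x) (ψ x) ≤ c) :
    SubAt F c (fun y => min (u y) (ψ y)) x := by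
  have hux : ContinuousAt u x := hu.continuousAt (hΩ.mem_nhds hx)
  rcases lt_trichotomy (u x) (ψ x) with h | h | h
  · refine (hsub x hx).congr ?_
    filter_upwards [hux.eventually_lt hψ.continuous.continuousAt h] with y hy
    exact min_eq_left hy.le
  · obtain ⟨ρ, hρ, hρΩ⟩ := nhds_basis_closedBall.mem_iff.1 (hΩ.mem_nhds hx)
    obtain ⟨m, hm, hmin⟩ := (isCompact_closedBall x ρ).exists_isMinOn
      ⟨x, mem_closedBall_self hρ.le⟩ (hu.mono hρΩ)
    obtain ⟨L, -, hL⟩ := hF.exists_lipschitz_const (‖x‖ + ρ) (u m) c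
    have hsubset : ball x ρ ⊆ Ω := ball_subset_closedBall.trans hρΩ
    refine SubAt.min_of_eq hF.continuous hF.convex hρ (fun y hy => hsub y (hsubset hy))
      (hL (ball x ρ) isOpen_ball (convex_ball x ρ) (fun y hy => ?_) u (hu.mono hsubset)
        (fun y hy => hsub y (hsubset hy)) (fun y hy => hmin (ball_subset_closedBall hy)))
      hψ (hψF h.ge) h
    have h1 := mem_ball_iff_norm.1 hy
    have h2 := norm_add_le x (y - x)
    rw [add_sub_cancel] at h2
    linarith
  · have h1 : SubAt F c ψ x := SubAt.of_hasGradientAt (hasGradientAt_gradient hψ x) (hψF h.le)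
    refine h1.congr ?_
    filter_upwards [hψ.continuous.continuousAt.eventually_lt hux h] with y hy
    exact min_eq_right hy.le

/-- A subsolution in a ball, cut off from above by a smooth function that is a subsolution outside
a smaller ball, extends to a global subsolution. -/
lemma SubAt.glue (hF : Regular F) {R₀ R₁ R₂ : ℝ} (hR : R₁ < R₂) (hR0 : R₀ ≤ R₂)
    (hu : ContinuousOn u (ball 0 R₂)) (hsub : ∀ x ∈ ball (0 : E n) R₂, SubAt F c u x)
    {ψ : E n → ℝ} (hψ : ContDiff ℝ 1 ψ)
    (hψF : ∀ x, R₀ ≤ ‖x‖ → F x (gradient ψ x) (ψ x) ≤ c)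
    (hin : ∀ x, ‖x‖ < R₀ → u x < ψ x)
    (hout : ∀ x, R₁ < ‖x‖ → ‖x‖ < R₂ → ψ x < u x) :
    Continuous (fun x => if ‖x‖ < R₂ then min (u x) (ψ x) else ψ x) ∧
      ∀ x, SubAt F c (fun x => if ‖x‖ < R₂ then min (u x) (ψ x) else ψ x) x := by
  have hloc1 : ∀ x : E n, ‖x‖ < R₂ →
      (fun x => if ‖x‖ < R₂ then min (u x) (ψ x) else ψ x) =ᶠ[𝓝 x] fun x => min (u x) (ψ x) := by
    intro x hx
    filter_upwards [isOpen_ball.mem_nhds (mem_ball_zero_iff.2 hx)] with y hy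
    rw [if_pos (mem_ball_zero_iff.1 hy)]
  have hloc2 : ∀ x : E n, R₂ ≤ ‖x‖ →
      (fun x => if ‖x‖ < R₂ then min (u x) (ψ x) else ψ x) =ᶠ[𝓝 x] ψ := by
    intro x hx
    filter_upwards [(continuous_norm.tendsto x).eventually_const_lt (hR.trans_le hx)] with y hy
    split_ifs with h
    · exact min_eq_right (hout y hy h).le
    · rfl
  constructor
  · rw [continuous_iff_continuousAt]
    intro x
    rcases lt_or_ge ‖x‖ R₂ with h | h
    · refine ContinuousAt.congr ?_ (hloc1 x h).symm
      exact (hu.continuousAt (isOpen_ball.mem_nhds (mem_ball_zero_iff.2 h))).min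
        hψ.continuous.continuousAt
    · exact hψ.continuous.continuousAt.congr (hloc2 x h).symm
  · intro x
    rcases lt_or_ge ‖x‖ R₂ with h | h
    · refine SubAt.congr ?_ (hloc1 x h)
      refine SubAt.min_smooth hF isOpen_ball (mem_ball_zero_iff.2 h) hsub hu hψ fun hle => ?_
      refine hψF x (not_lt.1 fun h' => ?_)
      exact absurd (hin x h') (not_lt.2 hle)
    · exact (SubAt.of_hasGradientAt (hasGradientAt_gradient hψ x)
        (hψF x (hR0.trans h))).congr (hloc2 x h)

/-- The smooth cone `C - ε √(1 + |x|²)`. -/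
noncomputable def cone (C ε : ℝ) (x : E n) : ℝ := C - ε * √(1 + ‖x‖ ^ 2)

lemma contDiff_cone (C ε : ℝ) : ContDiff ℝ 1 (cone C ε : E n → ℝ) := by
  refine contDiff_const.sub (contDiff_const.mul (ContDiff.sqrt ?_ fun x => by positivity))
  exact contDiff_const.add (contDiff_id.norm_sq ℝ)

lemma norm_gradient_cone_le {ε : ℝ} (hε : 0 ≤ ε) (C : ℝ) (x : E n) :
    ‖gradient (cone C ε) x‖ ≤ ε := by
  have h1 : ∀ s : ℝ, 0 < 1 + s → HasDerivAt (fun t : ℝ => C - ε * √(1 + t))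
      (-(ε * (1 / (2 * √(1 + s))))) s := fun s hs =>
    ((((hasDerivAt_id s).const_add 1).sqrt hs.ne').const_mul ε).const_sub C
  have h2 := HasGradientAt.scomp (g := fun t : ℝ => C - ε * √(1 + t))
    (h1 _ (by positivity)) (hasGradientAt_norm_sub_sq 1 0 x)
  have h3 : gradient (cone C ε) x = (-(ε * (1 / (2 * √(1 + 1 * ‖x - 0‖ ^ 2))))) •
      ((2 * (1 : ℝ)) • (x - 0)) := by
    refine HasGradientAt.gradient (h2.congr_of_eventuallyEq (Eventually.of_forall fun y => ?_))
    simp [cone]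
  rw [h3, smul_smul, norm_smul, sub_zero, one_mul, Real.norm_eq_abs]
  have hs : ‖x‖ ≤ √(1 + ‖x‖ ^ 2) := Real.le_sqrt_of_sq_le (by linarith)
  have hs0 : 0 < √(1 + ‖x‖ ^ 2) := Real.sqrt_pos.2 (by positivity)
  have h4 : |-(ε * (1 / (2 * √(1 + ‖x‖ ^ 2)))) * (2 * 1)| = ε / √(1 + ‖x‖ ^ 2) := by
    rw [neg_mul, abs_neg, abs_of_nonneg (by positivity)]
    field_simp
  rw [h4, div_mul_eq_mul_div, div_le_iff₀ hs0]
  exact mul_le_mul_of_nonneg_left hs hε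

lemma cone_le {ε : ℝ} (hε : 0 ≤ ε) (C : ℝ) (x : E n) : cone C ε x ≤ C - ε * ‖x‖ := by
  have hs : ‖x‖ ≤ √(1 + ‖x‖ ^ 2) := Real.le_sqrt_of_sq_le (by linarith)
  unfold cone
  linarith [mul_le_mul_of_nonneg_left hs hε]

lemma le_cone {ε : ℝ} (hε : 0 ≤ ε) (C : ℝ) (x : E n) : C - ε * (1 + ‖x‖) ≤ cone C ε x := by
  have hs : √(1 + ‖x‖ ^ 2) ≤ 1 + ‖x‖ := by
    rw [Real.sqrt_le_left (by positivity)]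
    nlinarith [norm_nonneg x]
  unfold cone
  linarith [mul_le_mul_of_nonneg_left hs hε]

/-! ### Comparison with state-constraint supersolutions -/

/-- Uniformly strict monotonicity in `u` for bounded `p`. -/
def StrictInValue (F : E n → E n → ℝ → ℝ) : Prop :=
  ∀ L : ℝ, ∃ κ > 0, ∀ x p, ‖p‖ ≤ L → ∀ r s, r ≤ s → F x p r + κ * (s - r) ≤ F x p s

/-- Doubling of variables with penalty `K |x - σ y|²`, where `σ < 1`. The dilation pushes the point
of the subsolution into the open ball, while the point of the supersolution may lie on the boundary.
The Lipschitz bound on `u` bounds the momenta independently of `K`, so one fixed penalty is enough.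
-/
theorem comparison_closedBall (hF : Regular F) (hS : StrictInValue F) {R : ℝ} (hR : 0 < R)
    {w : E n → ℝ} (hu : ContinuousOn u (closedBall 0 R))
    (hsub : ∀ x ∈ ball (0 : E n) R, SubAt F c u x) (hw : ContinuousOn w (closedBall 0 R))
    (hsup : IsViscositySupersolution F c (closedBall 0 R) w) :
    ∀ x ∈ closedBall (0 : E n) R, u x ≤ w x := by
  intro y₀ hy₀
  by_contra! hlt
  have hK := isCompact_closedBall (0 : E n) R
  have hne : (closedBall (0 : E n) R).Nonempty := ⟨y₀, hy₀⟩
  obtain ⟨b, hb, hbmin⟩ := hK.exists_isMinOn hne hu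
  obtain ⟨L, hL0, hL⟩ := hF.lipschitz_closedBall R (u b) c hR
  have hLip := hL u hu hsub fun x hx => hbmin (ball_subset_closedBall hx)
  obtain ⟨κ, hκ, hκF⟩ := hS (2 * L)
  obtain ⟨B, hB⟩ := hK.exists_bound_of_continuousOn hw
  set m := u y₀ - w y₀ with hm
  have hm0 : 0 < m := sub_pos.2 hlt
  have hUC := ((hK.prod ((isCompact_closedBall (0 : E n) (2 * L)).prod
    (isCompact_Icc (a := -B) (b := B)))).uniformContinuousOn_of_continuous
      hF.continuous.continuousOn)
  rw [Metric.uniformContinuousOn_iff] at hUC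
  obtain ⟨δ, hδ, hUC⟩ := hUC (κ * (m / 2)) (by positivity)
  obtain ⟨η, hη0, hη1, hηR, hηL, hηm⟩ : ∃ η : ℝ, 0 < η ∧ η ≤ 1 / 2 ∧ 2 * (η * R) < δ ∧
      2 * L * η < δ ∧ L * (η * R) ≤ m / 2 := by
    have hev : ∀ᶠ η in 𝓝[>] (0 : ℝ), η < 1 / 2 ∧ 2 * (η * R) < δ ∧ 2 * L * η < δ ∧
        L * (η * R) < m / 2 := by
      have key : ∀ f : ℝ → ℝ, Continuous f → ∀ a, f 0 < a → ∀ᶠ η in 𝓝[>] (0 : ℝ), f η < a :=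
        fun f hf a ha => ((hf.tendsto 0).mono_left nhdsWithin_le_nhds).eventually_lt_const ha
      exact (key _ continuous_id _ (by norm_num)).and ((key (fun η => 2 * (η * R)) (by fun_prop) _
        (by simpa)).and ((key (fun η => 2 * L * η) (by fun_prop) _ (by simpa)).and
          (key (fun η => L * (η * R)) (by fun_prop) _ (by simp; linarith))))
    obtain ⟨η, ⟨h1, h2, h3, h4⟩, h5⟩ := (hev.and self_mem_nhdsWithin).exists
    exact ⟨η, h5, h1.le, h2, h3, h4.le⟩
  set σ : ℝ := 1 - η with hσ
  have hσ0 : 0 < σ := by rw [hσ]; linarith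
  have hσ1 : σ ≤ 1 := by rw [hσ]; linarith
  -- Since maximality will give `K * d ≤ L`, this choice forces `d < η * R`, which is exactly the
  -- room gained by the dilation.
  set K : ℝ := (L + 1) / (η * R) with hKdef
  have hKpos : 0 < K := by positivity
  have hKLη : K * (η * R) = L + 1 := by rw [hKdef]; field_simp
  have hscale : ∀ y ∈ closedBall (0 : E n) R, σ • y ∈ closedBall (0 : E n) R := by
    intro y hy
    rw [mem_closedBall_zero_iff] at *
    rw [norm_smul, Real.norm_eq_abs, abs_of_pos hσ0]
    nlinarith [norm_nonneg y]
  have hcont : ContinuousOn (fun z : E n × E n => u z.1 - w z.2 - K * ‖z.1 - σ • z.2‖ ^ 2)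
      (closedBall 0 R ×ˢ closedBall 0 R) := by
    refine ((hu.comp continuousOn_fst fun z hz => hz.1).sub
      (hw.comp continuousOn_snd fun z hz => hz.2)).sub ?_
    fun_prop
  obtain ⟨⟨x, y⟩, ⟨hx, hy⟩, hmax⟩ := (hK.prod hK).exists_isMaxOn (hne.prod hne) hcont
  simp only at hx hy
  have hmax' : ∀ x' ∈ closedBall (0 : E n) R, ∀ y' ∈ closedBall (0 : E n) R,
      u x' - w y' - K * ‖x' - σ • y'‖ ^ 2 ≤ u x - w y - K * ‖x - σ • y‖ ^ 2 :=
    fun x' hx' y' hy' => hmax (mk_mem_prod hx' hy')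
  set d := ‖x - σ • y‖ with hd
  have hd0 : 0 ≤ d := norm_nonneg _
  have hKd : K * d ≤ L := by
    have h1 := hmax' _ (hscale y hy) y hy
    have h2 := hLip x hx _ (hscale y hy)
    rw [← hd] at h2
    simp only [sub_self, norm_zero] at h1
    rcases hd0.eq_or_lt with h | h
    · rw [← h]; simpa using hL0
    · have h3 : (K * d) * d ≤ L * d := by nlinarith
      exact le_of_mul_le_mul_right h3 h
  have hdη : d < η * R := by
    have : K * d < K * (η * R) := by linarith
    exact lt_of_mul_lt_mul_left this hKpos.le
  have hyR : ‖y‖ ≤ R := mem_closedBall_zero_iff.1 hy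
  have hxR : ‖x‖ < R := by
    have h1 : x = (x - σ • y) + σ • y := by abel
    have h2 : ‖x‖ ≤ d + σ * ‖y‖ := by
      conv_lhs => rw [h1]
      refine (norm_add_le _ _).trans ?_
      rw [norm_smul, Real.norm_eq_abs, abs_of_pos hσ0]
    have h3 : σ * ‖y‖ ≤ σ * R := mul_le_mul_of_nonneg_left hyR hσ0.le
    have h4 : σ * R = R - η * R := by rw [hσ]; ring
    linarith
  have hxy : ‖x - y‖ < δ := by
    have h1 : x - y = (x - σ • y) - η • y := by rw [hσ, sub_smul, one_smul]; abel
    rw [h1]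
    refine (norm_sub_le _ _).trans_lt ?_
    rw [norm_smul, Real.norm_eq_abs, abs_of_pos hη0]
    have : η * ‖y‖ ≤ η * R := mul_le_mul_of_nonneg_left hyR hη0.le
    linarith
  have hval : m / 2 ≤ u x - w y := by
    have h1 := hmax' _ (hscale y₀ hy₀) y₀ hy₀
    have h2 := hLip y₀ hy₀ _ (hscale y₀ hy₀)
    have h3 : ‖y₀ - σ • y₀‖ ≤ η * R := by
      have : y₀ - σ • y₀ = η • y₀ := by rw [hσ, sub_smul, one_smul]; abel
      rw [this, norm_smul, Real.norm_eq_abs, abs_of_pos hη0]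
      exact mul_le_mul_of_nonneg_left (mem_closedBall_zero_iff.1 hy₀) hη0.le
    have h4 := mul_le_mul_of_nonneg_left h3 hL0
    have h5 : 0 ≤ K * d ^ 2 := by positivity
    simp only [sub_self, norm_zero] at h1
    linarith
  set p : E n := (2 * K) • (x - σ • y) with hp
  have hpL : ‖p‖ ≤ 2 * L := by
    rw [hp, norm_smul, Real.norm_eq_abs, abs_of_pos (by positivity), ← hd]
    linarith
  have htest1 : F x p (u x) ≤ c := by
    have h := hsub x (mem_ball_zero_iff.2 hxR) _ (contDiff_norm_sub_sq K (σ • y)) ?_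
    · rwa [(hasGradientAt_norm_sub_sq K (σ • y) x).gradient] at h
    · filter_upwards [isOpen_ball.mem_nhds (mem_ball_zero_iff.2 hxR)] with z hz
      have := hmax' z (ball_subset_closedBall hz) y hy
      linarith
  have htest2 : c ≤ F y (σ • p) (w y) := by
    have hsq : ∀ z : E n, (-(K * σ ^ 2)) * ‖z - σ⁻¹ • x‖ ^ 2 = - (K * ‖x - σ • z‖ ^ 2) := by
      intro z
      have : x - σ • z = (-σ) • (z - σ⁻¹ • x) := by
        rw [smul_sub, smul_smul, neg_mul, mul_inv_cancel₀ hσ0.ne', neg_smul, neg_smul, one_smul]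
        abel
      rw [this, norm_smul, mul_pow, Real.norm_eq_abs, sq_abs]
      ring
    have h := hsup _ (contDiff_norm_sub_sq (-(K * σ ^ 2)) (σ⁻¹ • x)) y hy ?_
    · rw [(hasGradientAt_norm_sub_sq (-(K * σ ^ 2)) (σ⁻¹ • x) y).gradient] at h
      have hg : (2 * -(K * σ ^ 2)) • (y - σ⁻¹ • x) = σ • p := by
        rw [hp, smul_sub, smul_smul, smul_smul, smul_sub, smul_smul]
        have e1 : 2 * -(K * σ ^ 2) * σ⁻¹ = - (σ * (2 * K)) := by field_simp
        have e2 : 2 * -(K * σ ^ 2) = - (σ * (2 * K) * σ) := by ring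
        rw [e1, e2, neg_smul, neg_smul]
        abel
      rwa [hg] at h
    · filter_upwards [self_mem_nhdsWithin] with z hz
      have := hmax' x hx z hz
      rw [hsq, hsq]
      linarith
  have hwB : w y ∈ Icc (-B) B := abs_le.1 (hB y hy)
  have hpσ : ‖σ • p‖ ≤ 2 * L := by
    rw [norm_smul, Real.norm_eq_abs, abs_of_pos hσ0]
    nlinarith [norm_nonneg p]
  have hclose := hUC (x, p, w y) ⟨hx, mem_closedBall_zero_iff.2 hpL, hwB⟩
    (y, σ • p, w y) ⟨hy, mem_closedBall_zero_iff.2 hpσ, hwB⟩ (by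
      rw [Prod.dist_eq, Prod.dist_eq]
      refine max_lt (by rwa [dist_eq_norm]) (max_lt ?_ (by simpa using hδ))
      have : p - σ • p = η • p := by rw [hσ, sub_smul, one_smul]; abel
      rw [dist_eq_norm]
      simp only [this]
      rw [norm_smul, Real.norm_eq_abs, abs_of_pos hη0]
      nlinarith)
  simp only [Real.dist_eq] at hclose
  have h1 := (abs_lt.1 hclose).1
  have h2 := hκF x p hpL (w y) (u x) (by linarith)
  have h3 := mul_le_mul_of_nonneg_left hval hκ.le
  linarith

/-! ### Perron's method -/

/-- A raised, strictly subcritical copy of the test function is spliced in near `x₀`. The new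
function must be a subsolution only on `Ω`, so `x₀` may be a boundary point; this yields the state
constraint. -/
lemma exists_bump (hF : Regular F) {Ω S : Set (E n)} (hΩ : IsOpen Ω) (hΩS : Ω ⊆ S)
    (hu : ContinuousOn u S) (hsub : ∀ x ∈ Ω, SubAt F c u x) {φ : E n → ℝ} (hφ : ContDiff ℝ 1 φ)
    {x₀ : E n} (hmin : IsLocalMinOn (fun y => u y - φ y) S x₀)
    (hlt : F x₀ (gradient φ x₀) (u x₀) < c) :
    ∃ v : E n → ℝ, ContinuousOn v S ∧ (∀ x ∈ Ω, SubAt F c v x) ∧ u x₀ < v x₀ := by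
  have hG : Continuous (fun q : E n × ℝ => F q.1 (gradient φ q.1 + (2 * (-1 : ℝ)) • (q.1 - x₀))
      (φ q.1 + -1 * ‖q.1 - x₀‖ ^ 2 + (u x₀ - φ x₀ + q.2))) := by
    have h1 := (continuous_gradient hφ).comp (continuous_fst (X := E n) (Y := ℝ))
    have h2 := hφ.continuous.comp (continuous_fst (X := E n) (Y := ℝ))
    refine hF.continuous.comp
      (continuous_fst.prodMk ((h1.add ?_).prodMk ((h2.add ?_).add ?_)))
    all_goals fun_prop
  have hev := (hG.tendsto (x₀, 0)).eventually_lt_const (u := c) (by simpa using hlt)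
  obtain ⟨δ, hδ, hball⟩ := Metric.eventually_nhds_iff_ball.1 hev
  obtain ⟨r₁, hr₁, hmin'⟩ := Metric.mem_nhdsWithin_iff.1 hmin
  obtain ⟨r, hr, hrlt⟩ := exists_between (lt_min (lt_min hδ hr₁) one_pos)
  have hrδ : r < δ := hrlt.trans_le ((min_le_left _ _).trans (min_le_left _ _))
  have hrr₁ : r < r₁ := hrlt.trans_le ((min_le_left _ _).trans (min_le_right _ _))
  have hr1 : r < 1 := hrlt.trans_le (min_le_right _ _)
  -- The lift `r² / 2` is positive at `x₀`, yet smaller than the quadratic loss beyond `3 / 4 * r`,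
  -- because `1 / 2 < 9 / 16`.
  obtain ⟨θ, hθ⟩ : ∃ θ : E n → ℝ, θ = fun y =>
    φ y + -1 * ‖y - x₀‖ ^ 2 + (u x₀ - φ x₀ + r ^ 2 / 2) := ⟨_, rfl⟩
  have hθc : Continuous θ := by
    have := hφ.continuous
    rw [hθ]; fun_prop
  have hθsub : ∀ y, ‖y - x₀‖ < r → SubAt F c θ y := by
    intro y hy
    have hg : HasGradientAt θ (gradient φ y + (2 * (-1 : ℝ)) • (y - x₀)) y := by
      have := HasGradientAt.add (HasGradientAt.add (hasGradientAt_gradient hφ y)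
        (hasGradientAt_norm_sub_sq (-1) x₀ y)) (hasGradientAt_const y (u x₀ - φ x₀ + r ^ 2 / 2))
      rw [add_zero] at this
      rwa [hθ]
    refine SubAt.of_hasGradientAt hg ?_
    have h := hball (y, r ^ 2 / 2) (by
      rw [mem_ball, Prod.dist_eq]
      refine max_lt (by rw [dist_eq_norm]; exact hy.trans hrδ) ?_
      rw [dist_zero_right, Real.norm_eq_abs, abs_of_pos (by positivity)]
      nlinarith)
    rw [hθ]
    exact h.le
  have hθu : ∀ y ∈ S, ‖y - x₀‖ < r → 3 / 4 * r < ‖y - x₀‖ → θ y ≤ u y := by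
    intro y hy hyr hyr'
    have h1 : u x₀ - φ x₀ ≤ u y - φ y :=
      hmin' ⟨mem_ball_iff_norm.2 (hyr.trans hrr₁), hy⟩
    have h2 : (3 / 4 * r) ^ 2 ≤ ‖y - x₀‖ ^ 2 := by gcongr
    rw [hθ]
    simp only
    nlinarith
  obtain ⟨v, hv⟩ : ∃ v : E n → ℝ, v = fun y => if ‖y - x₀‖ < r then max (u y) (θ y) else u y :=
    ⟨_, rfl⟩
  have hloc1 : ∀ y, ‖y - x₀‖ < r → v =ᶠ[𝓝 y] fun y => max (u y) (θ y) := by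
    intro y hy
    filter_upwards [isOpen_ball.mem_nhds (mem_ball_iff_norm.2 hy)] with z hz
    rw [hv]
    exact if_pos (mem_ball_iff_norm.1 hz)
  have hloc2 : ∀ y, r ≤ ‖y - x₀‖ → v =ᶠ[𝓝[S] y] u := by
    intro y hy
    have hcn : Continuous fun z : E n => ‖z - x₀‖ := by fun_prop
    filter_upwards [self_mem_nhdsWithin, nhdsWithin_le_nhds ((hcn.tendsto y).eventually_const_lt
      (u := 3 / 4 * r) (by linarith))] with z hz hz'
    rw [hv]
    simp only
    split_ifs with h
    · exact max_eq_left (hθu z hz h hz')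
    · rfl
  refine ⟨v, fun y hy => ?_, fun y hy => ?_, ?_⟩
  · rcases lt_or_ge ‖y - x₀‖ r with h | h
    · have h1 := hloc1 y h
      have h2 : ContinuousWithinAt (fun y => max (u y) (θ y)) S y :=
        Tendsto.max (hu y hy) hθc.continuousWithinAt
      exact h2.congr_of_eventuallyEq (nhdsWithin_le_nhds h1) h1.eq_of_nhds
    · have h1 := hloc2 y h
      exact (hu y hy).congr_of_eventuallyEq h1 (h1.eq_of_nhdsWithin hy)
  · rcases lt_or_ge ‖y - x₀‖ r with h | h
    · exact ((hsub y hy).max (hθsub y h)).congr (hloc1 y h)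
    · have h1 := hloc2 y h
      rw [nhdsWithin_eq_nhds.2 (mem_of_superset (hΩ.mem_nhds hy) hΩS)] at h1
      exact (hsub y hy).congr h1
  · have h1 := (hloc1 x₀ (by simpa using hr)).eq_of_nhds
    rw [h1]
    refine lt_max_of_lt_right ?_
    rw [hθ]
    simp only [sub_self, norm_zero]
    nlinarith

/-- Only competitors above `w` enter the supremum, since these share local Lipschitz bounds. Nothing
is lost: any other subsolution may be replaced by its maximum with `w`. -/
theorem exists_perron_solution (hF : Regular F) {Ω S : Set (E n)} (hΩ : IsOpen Ω) (hΩS : Ω ⊆ S)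
    {w : E n → ℝ} (hwc : ContinuousOn w S) (hws : ∀ x ∈ Ω, SubAt F c w x)
    (hbdd : ∀ x ∈ S, ∃ M, ∀ v : E n → ℝ, ContinuousOn v S → (∀ y ∈ Ω, SubAt F c v y) → v x ≤ M)
    (hlip : ∀ x ∈ S, ∃ U ∈ 𝓝[S] x, ∃ L : ℝ, ∀ v : E n → ℝ, ContinuousOn v S →
      (∀ y ∈ Ω, SubAt F c v y) → (∀ y ∈ S, w y ≤ v y) →
        ∀ y ∈ U, ∀ z ∈ U, v y - v z ≤ L * ‖y - z‖) :
    ∃ u : E n → ℝ, ContinuousOn u S ∧ (∀ x ∈ Ω, SubAt F c u x) ∧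
      IsViscositySupersolution F c S u ∧
      ∀ v : E n → ℝ, ContinuousOn v S → (∀ y ∈ Ω, SubAt F c v y) → ∀ x ∈ S, v x ≤ u x := by
  obtain ⟨V, hV⟩ : ∃ V : Set (E n → ℝ), ∀ v, v ∈ V ↔
      ContinuousOn v S ∧ (∀ y ∈ Ω, SubAt F c v y) ∧ ∀ y ∈ S, w y ≤ v y :=
    ⟨{v | ContinuousOn v S ∧ (∀ y ∈ Ω, SubAt F c v y) ∧ ∀ y ∈ S, w y ≤ v y}, fun v => Iff.rfl⟩
  obtain ⟨u, hu⟩ : ∃ u : E n → ℝ, u = fun x => sSup ((fun v => v x) '' V) := ⟨_, rfl⟩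
  have hwV : w ∈ V := (hV w).2 ⟨hwc, hws, fun _ _ => le_rfl⟩
  have hbd : ∀ x ∈ S, BddAbove ((fun v : E n → ℝ => v x) '' V) := by
    intro x hx
    obtain ⟨M, hM⟩ := hbdd x hx
    refine ⟨M, ?_⟩
    rintro _ ⟨v, hv, rfl⟩
    exact hM v ((hV v).1 hv).1 ((hV v).1 hv).2.1
  have hle : ∀ v ∈ V, ∀ x ∈ S, v x ≤ u x := by
    intro v hv x hx
    rw [hu]
    exact le_csSup (hbd x hx) ⟨v, hv, rfl⟩
  have hsup : ∀ x, ∀ a, (∀ v ∈ V, v x ≤ a) → u x ≤ a := by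
    intro x a h
    rw [hu]
    refine csSup_le ⟨_, w, hwV, rfl⟩ ?_
    rintro _ ⟨v, hv, rfl⟩
    exact h v hv
  have hmaxl : ∀ v : E n → ℝ, ContinuousOn v S → (∀ y ∈ Ω, SubAt F c v y) →
      ∀ x ∈ S, v x ≤ u x := by
    intro v hvc hvs x hx
    refine (le_max_left (v x) (w x)).trans (hle (fun y => max (v y) (w y)) ?_ x hx)
    exact (hV _).2 ⟨fun y hy => Tendsto.max (hvc y hy) (hwc y hy),
      fun y hy => (hvs y hy).max (hws y hy), fun y _ => le_max_right _ _⟩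
  have hucont : ContinuousOn u S := by
    intro x hx
    obtain ⟨U, hU, L, hL⟩ := hlip x hx
    have hLu : ∀ y ∈ U ∩ S, ∀ z ∈ U ∩ S, u y - u z ≤ L * ‖y - z‖ := by
      rintro y ⟨hyU, hyS⟩ z ⟨hzU, hzS⟩
      rw [sub_le_iff_le_add]
      refine hsup y _ fun v hv => ?_
      have h1 := hL v ((hV v).1 hv).1 ((hV v).1 hv).2.1 ((hV v).1 hv).2.2 y hyU z hzU
      have h2 := hle v hv z hzS
      linarith
    have hUS : U ∩ S ∈ 𝓝[S] x := inter_mem hU self_mem_nhdsWithin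
    have h := (lipschitzOnWith_of_sub_le hLu).continuousOn x (mem_of_mem_nhdsWithin hx hUS)
    exact h.mono_of_mem_nhdsWithin hUS
  have husub : ∀ x ∈ Ω, SubAt F c u x := by
    intro x hx
    obtain ⟨ρ, hρ, hρΩ⟩ := Metric.isOpen_iff.1 hΩ x hx
    refine SubAt.of_approx hF.continuous hF.monotone hρ V
      (fun v hv y hy => ((hV v).1 hv).2.1 y (hρΩ hy))
      (fun v hv => ((hV v).1 hv).1.mono (hρΩ.trans hΩS))
      (fun v hv y hy => hle v hv y (hΩS (hρΩ hy))) fun η hη => ?_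
    by_contra! hcon
    have := hsup x _ hcon
    linarith
  refine ⟨u, hucont, husub, fun φ hφ x hx hmin => ?_, hmaxl⟩
  by_contra! hlt
  obtain ⟨v, hvc, hvs, hvx⟩ := exists_bump hF hΩ hΩS hucont husub hφ hmin hlt
  exact absurd (hmaxl v hvc hvs x hx) (not_le.2 hvx)

/-! ### The Hamiltonians of the problem -/

lemma SubAt.imp {G : E n → E n → ℝ → ℝ} {c' : ℝ} (h : SubAt F c u x)
    (hi : ∀ p, F x p (u x) ≤ c → G x p (u x) ≤ c') : SubAt G c' u x :=
  fun φ hφ hm => hi _ (h φ hφ hm)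

lemma SubAt.add_const {G : E n → E n → ℝ → ℝ} {c' : ℝ} (k : ℝ) (h : SubAt F c u x)
    (hi : ∀ p, F x p (u x) ≤ c → G x p (u x + k) ≤ c') : SubAt G c' (fun y => u y + k) x := by
  intro φ hφ hm
  refine hi _ (h φ hφ ?_)
  filter_upwards [hm] with y hy
  linarith

variable {H : E n → E n → ℝ → ℝ}

lemma AssumptionH1.exists_coercive (h1 : AssumptionH1 H) (R b M : ℝ) :
    ∃ L, 0 ≤ L ∧ ∀ x, ‖x‖ ≤ R → ∀ p, H x p b ≤ M → ‖p‖ ≤ L := by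
  obtain ⟨r, hr⟩ := h1.coercive (closedBall 0 R) (isCompact_closedBall 0 R) {b} isCompact_singleton
    (M + 1)
  refine ⟨max r 0, le_max_right _ _, fun x hx p hp => ?_⟩
  by_contra! hlt
  have := hr x (mem_closedBall_zero_iff.2 hx) b rfl p ((le_max_left _ _).trans hlt.le)
  linarith

lemma AssumptionH1.regular_frozen (h1 : AssumptionH1 H) (b : ℝ) :
    Regular (fun x p (_ : ℝ) => H x p b) where
  continuous := h1.continuous.comp (f := fun q : E n × E n × ℝ => (q.1, q.2.1, b)) (by fun_prop)
  monotone _ _ _ _ _ := le_rfl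
  convex x _ := h1.convex x b
  coercive R _ M := h1.exists_coercive R b M

lemma AssumptionH1.regular_discounted (h1 : AssumptionH1 H) {lam : ℝ} (hlam : 0 ≤ lam) :
    Regular (fun x p r => H x p (lam * r)) where
  continuous := h1.continuous.comp (f := fun q : E n × E n × ℝ => (q.1, q.2.1, lam * q.2.2))
    (by fun_prop)
  monotone x p _ _ h := h1.monotone x p (mul_le_mul_of_nonneg_left h hlam)
  convex x r := h1.convex x (lam * r)
  coercive R b M := h1.exists_coercive R (lam * b) M

lemma AssumptionH3.exists_lower_rate (h3 : AssumptionH3 H) : StrictInValue H := by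
  intro L
  obtain ⟨κ, _, hκ, hb⟩ := h3.bounds (max L 1) (by positivity)
  refine ⟨κ, hκ, fun x p hp r s hrs => ?_⟩
  have := mul_sub_le_image_sub_of_le_deriv (h3.differentiable x p)
    (fun t => (hb x p (hp.trans (le_max_left _ _)) t).1) hrs
  linarith

lemma AssumptionH3.exists_upper_rate (h3 : AssumptionH3 H) (L : ℝ) :
    ∃ κ > 0, ∀ x p, ‖p‖ ≤ L → ∀ r s, r ≤ s → H x p s ≤ H x p r + κ * (s - r) := by
  obtain ⟨κ₁, κ, hκ₁, hb⟩ := h3.bounds (max L 1) (by positivity)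
  have hκ : κ₁ ≤ κ := by
    have := hb 0 0 (by simp) 0
    linarith
  refine ⟨κ, by linarith, fun x p hp r s hrs => ?_⟩
  have := image_sub_le_mul_sub_of_deriv_le (h3.differentiable x p)
    (fun t => (hb x p (hp.trans (le_max_left _ _)) t).2) hrs
  linarith

lemma AssumptionH3.strictInValue_discounted (h3 : AssumptionH3 H) {lam : ℝ} (hlam : 0 < lam) :
    StrictInValue (fun x p r => H x p (lam * r)) := by
  intro L
  obtain ⟨κ, hκ, h⟩ := h3.exists_lower_rate L
  refine ⟨κ * lam, by positivity, fun x p hp r s hrs => ?_⟩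
  have := h x p hp (lam * r) (lam * s) (mul_le_mul_of_nonneg_left hrs hlam.le)
  linarith

/-! ### The critical value -/

/-- A steep paraboloid touches `u` arbitrarily close to `x`, so some momentum is admissible there.
Coercivity confines the momenta to a compact set, on which the lower bound at `x` nearly persists at
neighbouring points. -/
lemma Regular.le_level_of_subAt (hF : Regular (fun x p (_ : ℝ) => H x p 0)) {a b : ℝ}
    (hu : Continuous u) (hsub : ∀ y, SubAt (fun x p (_ : ℝ) => H x p 0) a u y)
    (hb : ∀ p, b ≤ H x p 0) : b ≤ a := by
  by_contra! hab
  obtain ⟨b', hab', hbb'⟩ := exists_between hab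
  obtain ⟨L, hL0, hL⟩ := hF.coercive (‖x‖ + 1) 0 b'
  have hcont : Continuous fun q : E n × E n => H q.1 q.2 0 :=
    hF.continuous.comp (f := fun q : E n × E n => (q.1, q.2, (0 : ℝ))) (by fun_prop)
  have hev : ∀ᶠ y in 𝓝 x, ∀ p ∈ closedBall (0 : E n) L, b' < H y p 0 :=
    (isCompact_closedBall (0 : E n) L).eventually_forall_of_forall_eventually fun p _ =>
      (hcont.tendsto (x, p)).eventually_const_lt (hbb'.trans_le (hb p))
  obtain ⟨δ, hδ, hball⟩ := Metric.eventually_nhds_iff_ball.1 hev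
  obtain ⟨r, hr, hrlt⟩ := exists_between (lt_min hδ one_pos)
  obtain ⟨m, hm, hmax⟩ := (isCompact_closedBall x r).exists_isMaxOn
    ⟨x, mem_closedBall_self hr.le⟩ hu.continuousOn
  have hmx : u x ≤ u m := hmax (mem_closedBall_self hr.le)
  obtain ⟨y, hy, hFy, -⟩ := exists_touching (v := u) hr (fun y _ => hsub y) hu.continuousOn
    (contDiff_norm_sub_sq ((u m - u x + 1) / r ^ 2) x) (by
      intro y hy
      have h1 : u y ≤ u m := hmax (sphere_subset_closedBall hy)
      have h2 : (u m - u x + 1) / r ^ 2 * r ^ 2 = u m - u x + 1 := by field_simp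
      rw [mem_sphere_iff_norm.1 hy, h2]
      simp only [sub_self, norm_zero]
      linarith)
  have hyr := mem_ball_iff_norm.1 hy
  have hyn : ‖y‖ ≤ ‖x‖ + 1 := by
    have h2 := norm_add_le x (y - x)
    rw [add_sub_cancel] at h2
    linarith [min_le_right δ 1]
  have hp := hL y hyn _ (hFy.trans hab'.le)
  have := hball y (mem_ball_iff_norm.2 (by linarith [min_le_left δ 1])) _
    (mem_closedBall_zero_iff.2 hp)
  linarith

/-- The critical value is the infimum of a nonempty set bounded below, and at infinity small
momenta are strictly subcritical. -/
theorem exists_critical_data (h1 : AssumptionH1 H) (h2 : AssumptionH2 H) :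
    (∀ a, criticalValue H < a → ∃ u : E n → ℝ, Continuous u ∧
      ∀ x, SubAt (fun x p (_ : ℝ) => H x p 0) a u x) ∧
    (∀ a (u : E n → ℝ), Continuous u → (∀ x, SubAt (fun x p (_ : ℝ) => H x p 0) a u x) →
      criticalValue H ≤ a) ∧
    ∃ ε > 0, ∃ δ > 0, ∃ R₀ > 0, ∀ x, R₀ ≤ ‖x‖ → ∀ p, ‖p‖ ≤ ε →
      H x p 0 ≤ criticalValue H - δ := by
  have hF := h1.regular_frozen 0
  obtain ⟨ε, hε, hlim, -⟩ := h2
  obtain ⟨m, hm1, hm2⟩ := EReal.lt_iff_exists_real_btwn.1 hlim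
  obtain ⟨x₁, hx₁⟩ := lt_iSup_iff.1 hm2
  obtain ⟨m', hm'1, hm'2⟩ := EReal.lt_iff_exists_real_btwn.1 hx₁
  have hmm' : m < m' := EReal.coe_lt_coe_iff.1 hm'1
  have hlow : ∀ p, m' ≤ H x₁ p 0 := fun p =>
    EReal.coe_le_coe_iff.1 (hm'2.le.trans (iInf_le _ p))
  have hev := eventually_lt_of_limsup_lt hm1
  rw [← comap_norm_atTop, eventually_comap, eventually_atTop] at hev
  obtain ⟨R, hR⟩ := hev
  have hfar : ∀ x : E n, R ≤ ‖x‖ → ∀ p, ‖p‖ ≤ ε → H x p 0 ≤ m := by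
    intro x hx p hp
    have h := hR ‖x‖ hx x rfl
    have h' := (le_iSup₂ (f := fun (p : E n) (_ : p ∈ closedBall (0 : E n) ε) =>
      (H x p 0 : EReal)) p (mem_closedBall_zero_iff.2 hp)).trans_lt h
    exact (EReal.coe_lt_coe_iff.1 h').le
  obtain ⟨A, hA⟩ : ∃ A : Set ℝ, A = {a : ℝ | ∃ u : E n → ℝ, Continuous u ∧
    IsViscositySubsolution (fun x p (_ : ℝ) => H x p 0) a univ u} := ⟨_, rfl⟩
  have hmem : ∀ a, a ∈ A ↔ ∃ u : E n → ℝ, Continuous u ∧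
      ∀ x, SubAt (fun x p (_ : ℝ) => H x p 0) a u x := by
    intro a
    rw [hA]
    refine exists_congr fun u => and_congr_right fun _ => ?_
    rw [isViscositySubsolution_iff isOpen_univ]
    simp
  have hcA : criticalValue H = sInf A := by rw [hA]; rfl
  have hlb : ∀ a ∈ A, m' ≤ a := by
    intro a ha
    obtain ⟨u, hu, hsub⟩ := (hmem a).1 ha
    exact hF.le_level_of_subAt hu hsub hlow
  have hbdd : BddBelow A := ⟨m', hlb⟩
  have hne : A.Nonempty := by
    have hcont : Continuous fun x : E n => H x 0 0 :=
      h1.continuous.comp (f := fun x : E n => (x, (0 : E n), (0 : ℝ))) (by fun_prop)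
    obtain ⟨B, hB⟩ := (isCompact_closedBall (0 : E n) R).exists_bound_of_continuousOn
      hcont.continuousOn
    refine ⟨max B m, (hmem _).2 ⟨fun _ => 0, continuous_const, fun x => ?_⟩⟩
    refine SubAt.of_hasGradientAt (hasGradientAt_const x 0) ?_
    rcases le_total R ‖x‖ with h | h
    · exact (hfar x h 0 (by simpa using hε.le)).trans (le_max_right _ _)
    · exact ((le_abs_self _).trans (hB x (mem_closedBall_zero_iff.2 h))).trans (le_max_left _ _)
  refine ⟨fun a ha => ?_, fun a u hu hsub => ?_, ε, hε, m' - m, by linarith, max R 1,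
    by positivity, fun x hx p hp => ?_⟩
  · rw [hcA] at ha
    obtain ⟨a', ha'A, ha'⟩ := exists_lt_of_csInf_lt hne ha
    obtain ⟨u, hu, hsub⟩ := (hmem a').1 ha'A
    exact ⟨u, hu, fun x => (hsub x).imp fun p hp => hp.trans ha'.le⟩
  · rw [hcA]
    exact csInf_le hbdd ((hmem a).2 ⟨u, hu, hsub⟩)
  · have h3 : m' ≤ criticalValue H := by rw [hcA]; exact le_csInf hne hlb
    have h4 := hfar x ((le_max_left _ _).trans hx) p hp
    linarith

/-! ### Bounded subsolutions -/

/-- Replacing a subsolution by its maximum with a constant, where the constant lies below it on a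
closed ball and is a subsolution outside. -/
lemma subAt_max_const {R₀ k : ℝ} (hux : ContinuousAt u x)
    (hsub : k ≤ u x → SubAt F c u x) (hk : R₀ < ‖x‖ → F x 0 k ≤ c)
    (hlt : ‖x‖ ≤ R₀ → k < u x) : SubAt F c (fun y => max (u y) k) x := by
  rcases lt_or_ge k (u x) with h | h
  · refine (hsub h.le).congr ?_
    filter_upwards [hux.eventually (lt_mem_nhds h)] with y hy
    exact max_eq_left (le_of_lt hy)
  · have hx : R₀ < ‖x‖ := not_le.1 fun h' => absurd (hlt h') (not_lt.2 h)
    have hconst : SubAt F c (fun _ => k) x :=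
      SubAt.of_hasGradientAt (hasGradientAt_const x k) (hk hx)
    rcases h.lt_or_eq with h | h
    · refine hconst.congr ?_
      filter_upwards [hux.eventually (gt_mem_nhds h)] with y hy
      exact max_eq_right (le_of_lt hy)
    · exact (hsub h.ge).max hconst

/-- Almost critical subsolutions with bounds and gradient bounds independent of the level. -/
lemma exists_bounded_subsolution (h1 : AssumptionH1 H) (h2 : AssumptionH2 H) :
    ∃ A L : ℝ, 0 ≤ A ∧ ∀ a ∈ Ioc (criticalValue H) (criticalValue H + 1),
      ∃ w : E n → ℝ, Continuous w ∧ (∀ x, |w x| ≤ A) ∧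
        (∀ x, SubAt (fun x p (_ : ℝ) => H x p 0) a w x) ∧
        ∀ x, SubAt (fun _ p (_ : ℝ) => ‖p‖) L w x := by
  obtain ⟨hex, -, ε, hε, δ, hδ, R₀, hR₀, hfar⟩ := exists_critical_data h1 h2
  have hF := h1.regular_frozen 0
  obtain ⟨L₁, hL₁0, hL₁⟩ := hF.coercive (R₀ + 1) 0 (criticalValue H + 1)
  obtain ⟨B, hB⟩ : ∃ B, B = L₁ * (R₀ + 1) := ⟨_, rfl⟩
  have hB0 : 0 ≤ B := by rw [hB]; positivity
  obtain ⟨C, hC⟩ : ∃ C, C = B + 1 + ε * (1 + R₀) := ⟨_, rfl⟩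
  have hC0 : 0 < C := by rw [hC]; positivity
  -- `C` puts the cone above `B` on the ball of radius `R₀`; beyond `R₁` the cone is below `-B - 3`,
  -- hence below both truncation levels `-B - 1` and `-B - 2`.
  obtain ⟨R₁, hR₁⟩ : ∃ R₁, R₁ = (C + B + 3) / ε := ⟨_, rfl⟩
  have hεR₁ : ε * R₁ = C + B + 3 := by rw [hR₁]; field_simp
  have hR₀₁ : R₀ < R₁ := by
    refine lt_of_mul_lt_mul_left ?_ hε.le
    rw [hεR₁, hC]
    nlinarith
  obtain ⟨L, hL0, hL⟩ := hF.coercive R₁ 0 (criticalValue H + 1)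
  refine ⟨B + 2 + C, L, by positivity, fun a ha => ?_⟩
  obtain ⟨hac, hac1⟩ := ha
  obtain ⟨u₀, hu₀, hu₀sub⟩ := hex a hac
  obtain ⟨w₀, hw₀⟩ : ∃ w₀ : E n → ℝ, w₀ = fun y => u₀ y + -u₀ 0 := ⟨_, rfl⟩
  have hw₀c : Continuous w₀ := by rw [hw₀]; fun_prop
  have hw₀sub : ∀ x, SubAt (fun x p (_ : ℝ) => H x p 0) a w₀ x := by
    intro x
    rw [hw₀]
    exact (hu₀sub x).add_const _ fun p hp => hp
  have hw₀B : ∀ x, ‖x‖ ≤ R₀ → |w₀ x| ≤ B := by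
    have hLip := fun (x y : E n) (hx : x ∈ ball (0 : E n) (R₀ + 1))
      (hy : y ∈ ball (0 : E n) (R₀ + 1)) => SubAt.sub_le isOpen_ball (convex_ball 0 (R₀ + 1))
      hw₀c.continuousOn (fun x _ => hw₀sub x) hL₁0 (fun x hx p hp =>
        hL₁ x (mem_ball_zero_iff.1 hx).le p (hp.trans hac1)) hx hy
    intro x hx
    have hx' : x ∈ ball (0 : E n) (R₀ + 1) := by rw [mem_ball_zero_iff]; linarith
    have h0' : (0 : E n) ∈ ball (0 : E n) (R₀ + 1) := mem_ball_self (by linarith)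
    have e1 := hLip x 0 hx' h0'
    have e2 := hLip 0 x h0' hx'
    have e3 : w₀ 0 = 0 := by rw [hw₀]; simp
    rw [e3, zero_sub, zero_sub, norm_neg] at e1
    rw [e3, sub_zero, sub_zero] at e2
    have e4 : L₁ * ‖x‖ ≤ B := by
      rw [hB]; exact mul_le_mul_of_nonneg_left (by linarith) hL₁0
    exact abs_le.2 ⟨by linarith, by linarith⟩
  have hfar0 : ∀ x : E n, R₀ < ‖x‖ → H x 0 0 ≤ a := fun x hx => by
    have := hfar x hx.le 0 (by simpa using hε.le)
    linarith
  -- The lower truncation ensures that the descending cone eventually falls below the function, as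
  -- gluing requires.
  obtain ⟨w₁, hw₁⟩ : ∃ w₁ : E n → ℝ, w₁ = fun y => max (w₀ y) (-B - 1) := ⟨_, rfl⟩
  have hw₁c : Continuous w₁ := by rw [hw₁]; fun_prop
  have hw₁sub : ∀ x, SubAt (fun x p (_ : ℝ) => H x p 0) a w₁ x := by
    intro x
    rw [hw₁]
    refine subAt_max_const hw₀c.continuousAt (fun _ => hw₀sub x) (hfar0 x) fun hx => ?_
    linarith [(abs_le.1 (hw₀B x hx)).1]
  have hw₁ge : ∀ x, -B - 1 ≤ w₁ x := fun x => by rw [hw₁]; exact le_max_right _ _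
  obtain ⟨hw₂c, hw₂sub⟩ := SubAt.glue (ψ := cone C ε) hF (R₀ := R₀) (R₁ := R₁) (R₂ := R₁ + 1)
    (by linarith) (by linarith) hw₁c.continuousOn (fun x _ => hw₁sub x) (contDiff_cone C ε)
    (fun x hx => by
      have := hfar x hx _ (norm_gradient_cone_le hε.le C x)
      linarith)
    (fun x hx => by
      have e1 := le_cone hε.le C x
      have e2 : ε * (1 + ‖x‖) ≤ ε * (1 + R₀) := mul_le_mul_of_nonneg_left (by linarith) hε.le
      have e3 := (abs_le.1 (hw₀B x hx.le)).2
      have e4 : w₁ x ≤ B := by rw [hw₁]; exact max_le e3 (by linarith)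
      linarith)
    (fun x hx _ => by
      have e1 := cone_le hε.le C x
      have e2 : ε * R₁ ≤ ε * ‖x‖ := mul_le_mul_of_nonneg_left hx.le hε.le
      have e3 := hw₁ge x
      linarith)
  obtain ⟨w₂, hw₂⟩ : ∃ w₂ : E n → ℝ, w₂ =
    fun x => if ‖x‖ < R₁ + 1 then min (w₁ x) (cone C ε x) else cone C ε x := ⟨_, rfl⟩
  rw [← hw₂] at hw₂c hw₂sub
  have hw₂le : ∀ x, w₂ x ≤ cone C ε x := by
    intro x
    rw [hw₂]
    simp only
    split_ifs
    · exact min_le_right _ _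
    · exact le_rfl
  -- A second truncation makes the function constant beyond `R₁`, so a gradient bound on one ball
  -- becomes global.
  have hcont : Continuous fun y => max (w₂ y) (-B - 2) := by fun_prop
  have hsub : ∀ x, SubAt (fun x p (_ : ℝ) => H x p 0) a (fun y => max (w₂ y) (-B - 2)) x := by
    intro x
    refine subAt_max_const hw₂c.continuousAt (fun _ => hw₂sub x) (hfar0 x) fun hx => ?_
    rw [hw₂]
    simp only
    rw [if_pos (by linarith)]
    refine lt_min (by linarith [hw₁ge x]) ?_
    have e1 := le_cone hε.le C x
    have e2 : ε * (1 + ‖x‖) ≤ ε * (1 + R₀) := mul_le_mul_of_nonneg_left (by linarith) hε.le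
    linarith
  refine ⟨fun y => max (w₂ y) (-B - 2), hcont, fun x => ?_, hsub, fun x => ?_⟩
  · have e1 := cone_le hε.le C x
    have e2 : 0 ≤ ε * ‖x‖ := by positivity
    have e3 := hw₂le x
    exact abs_le.2 ⟨le_trans (by linarith) (le_max_right _ _), max_le (by linarith) (by linarith)⟩
  · rcases le_or_gt ‖x‖ R₁ with hx | hx
    · exact (hsub x).imp fun p hp => hL x hx p (hp.trans hac1)
    · have hconst : SubAt (fun (_ : E n) p (_ : ℝ) => ‖p‖) L (fun _ => -B - 2) x :=
        SubAt.of_hasGradientAt (hasGradientAt_const x _) (by simpa using hL0)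
      refine hconst.congr ?_
      filter_upwards [(continuous_norm.tendsto x).eventually_const_lt hx] with y hy
      have e1 := cone_le hε.le C y
      have e2 : ε * R₁ ≤ ε * ‖y‖ := mul_le_mul_of_nonneg_left hy.le hε.le
      have e3 := hw₂le y
      exact max_eq_right (by linarith)

/-- A bounded subsolution at level at most `κ * lam` above critical is shifted until it is at most
`-1`. The discount then lowers the Hamiltonian by at least `κ * lam`, offsetting the excess. The
rate `κ` is uniform because the gradients are bounded by `L`, so `K` does not depend on `lam`. -/
lemma exists_discounted_subsolution (h1 : AssumptionH1 H) (h2 : AssumptionH2 H)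
    (h3 : AssumptionH3 H) :
    ∃ K : ℝ, 0 ≤ K ∧ ∀ lam : ℝ, 0 < lam → ∃ g : E n → ℝ, Continuous g ∧ (∀ x, -K ≤ g x) ∧
      ∀ x, SubAt (fun x p r => H x p (lam * r)) (criticalValue H) g x := by
  obtain ⟨A, L, hA0, hw⟩ := exists_bounded_subsolution h1 h2
  obtain ⟨κ, hκ, hrate⟩ := h3.exists_lower_rate L
  refine ⟨2 * A + 1, by positivity, fun lam hlam => ?_⟩
  have hκl : 0 < κ * lam := by positivity
  obtain ⟨w, hwc, hwA, hwsub, hwgrad⟩ := hw (criticalValue H + min 1 (κ * lam))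
    ⟨by linarith [lt_min one_pos hκl], by linarith [min_le_left 1 (κ * lam)]⟩
  refine ⟨fun y => w y + (-A - 1), by fun_prop, fun x => ?_, fun x φ hφ hm => ?_⟩
  · linarith [(abs_le.1 (hwA x)).1]
  · have hm' : IsLocalMax (fun y => w y - φ y) x := by
      filter_upwards [hm] with y hy
      linarith
    have e1 := hwsub x φ hφ hm'
    have e2 := hwgrad x φ hφ hm'
    have e3 : w x + (-A - 1) ≤ -1 := by linarith [(abs_le.1 (hwA x)).2]
    have e4 : lam * (w x + (-A - 1)) ≤ -lam := by nlinarith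
    have e5 := hrate x _ e2 (lam * (w x + (-A - 1))) 0 (by linarith)
    have e6 := mul_le_mul_of_nonneg_left e4 hκ.le
    have e7 := min_le_right 1 (κ * lam)
    simp only at e1 ⊢
    linarith

/-! ### Existence of solutions -/

lemma exists_stateConstraintSolution (h1 : AssumptionH1 H) (h2 : AssumptionH2 H)
    (h3 : AssumptionH3 H) {lam R : ℝ} (hlam : 0 < lam) (hR : 0 < R) :
    ∃ w : E n → ℝ, IsStateConstraintSolution H lam R w := by
  have hF := h1.regular_discounted hlam.le
  have hS := h3.strictInValue_discounted hlam
  obtain ⟨K, -, hK⟩ := exists_discounted_subsolution h1 h2 h3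
  obtain ⟨g, hgc, hgK, hgsub⟩ := hK lam hlam
  obtain ⟨L, -, hL⟩ := h1.exists_coercive R 0 (criticalValue H)
  obtain ⟨κ, hκ, hrate⟩ := h3.exists_lower_rate L
  have hcont : Continuous fun q : E n × E n => H q.1 q.2 0 :=
    h1.continuous.comp (f := fun q : E n × E n => (q.1, q.2, (0 : ℝ))) (by fun_prop)
  obtain ⟨B, hB⟩ := ((isCompact_closedBall (0 : E n) R).prod
    (isCompact_closedBall (0 : E n) L)).exists_bound_of_continuousOn hcont.continuousOn
  -- The constant `M` is a supersolution up to the boundary, where any gradient may be tested: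
  -- either the momentum is already supercritical, or it is at most `L` and the growth in the value
  -- suffices.
  obtain ⟨M, hM⟩ : ∃ M, M = |criticalValue H + B| / (κ * lam) := ⟨_, rfl⟩
  have hM0 : 0 ≤ M := by rw [hM]; positivity
  have hMκ : κ * (lam * M) = |criticalValue H + B| := by rw [hM]; field_simp
  have hsuper : IsViscositySupersolution (fun x p r => H x p (lam * r)) (criticalValue H)
      (closedBall 0 R) (fun _ => M) := by
    intro φ _ x hx _
    have hlM : 0 ≤ lam * M := by positivity
    rcases le_or_gt (H x (gradient φ x) 0) (criticalValue H) with h | h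
    · have hp := hL x (mem_closedBall_zero_iff.1 hx) _ h
      have e1 := hrate x _ hp 0 (lam * M) hlM
      have e2 := (abs_le.1 (hB (x, gradient φ x) ⟨hx, mem_closedBall_zero_iff.2 hp⟩)).1
      have e3 := le_abs_self (criticalValue H + B)
      simp only at e2 ⊢
      rw [sub_zero, hMκ] at e1
      linarith
    · exact h.le.trans (h1.monotone x _ hlM)
  obtain ⟨Λ, -, hΛ⟩ := hF.lipschitz_closedBall R (-K) (criticalValue H) hR
  obtain ⟨w, hwc, hwsub, hwsup, -⟩ := exists_perron_solution hF
    (isOpen_ball (x := (0 : E n)) (ε := R)) ball_subset_closedBall hgc.continuousOn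
    (fun x _ => hgsub x)
    (fun x hx => ⟨M, fun v hv hvs => comparison_closedBall hF hS hR hv hvs continuousOn_const
      hsuper x hx⟩)
    (fun x _ => ⟨closedBall 0 R, self_mem_nhdsWithin, Λ, fun v hv hvs hgv =>
      hΛ v hv hvs fun y hy => (hgK y).trans (hgv y (ball_subset_closedBall hy))⟩)
  exact ⟨w, hwc, (isViscositySubsolution_iff isOpen_ball).2 hwsub, hwsup⟩

/-- State-constraint solutions in balls bound all global subsolutions locally, so Perron's method
applies on the whole space. Domination of subsolutions, not just of solutions, is what the main
theorem needs. -/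
lemma exists_maximalSolution (h1 : AssumptionH1 H) (h2 : AssumptionH2 H)
    (h3 : AssumptionH3 H) {lam : ℝ} (hlam : 0 < lam) :
    ∃ u : E n → ℝ, IsMaximalSolution H lam u ∧ ∀ v : E n → ℝ, Continuous v →
      (∀ x, SubAt (fun x p r => H x p (lam * r)) (criticalValue H) v x) → v ≤ u := by
  have hF := h1.regular_discounted hlam.le
  have hS := h3.strictInValue_discounted hlam
  obtain ⟨K, -, hK⟩ := exists_discounted_subsolution h1 h2 h3
  obtain ⟨g, hgc, hgK, hgsub⟩ := hK lam hlam
  obtain ⟨u, huc, husub, husup, hmax⟩ := exists_perron_solution hF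
    (isOpen_univ (X := E n)) subset_rfl hgc.continuousOn
    (fun x _ => hgsub x)
    (fun x _ => by
      have hR : 0 < ‖x‖ + 1 := by positivity
      obtain ⟨w, hwc, -, hwsup⟩ := exists_stateConstraintSolution h1 h2 h3 hlam hR
      exact ⟨w x, fun v hv hvs => comparison_closedBall hF hS hR (hv.mono (subset_univ _))
        (fun y _ => hvs y (mem_univ y)) hwc hwsup x
        (mem_closedBall_zero_iff.2 (by linarith))⟩)
    (fun x _ => by
      obtain ⟨L, -, hL⟩ := hF.exists_lipschitz_const (‖x‖ + 1) (-K) (criticalValue H)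
      refine ⟨ball x 1, mem_nhdsWithin_of_mem_nhds (ball_mem_nhds x one_pos), L,
        fun v hv hvs hgv => hL _ isOpen_ball (convex_ball x 1) (fun y hy => ?_) v
          (hv.mono (subset_univ _)) (fun y _ => hvs y (mem_univ y))
          fun y _ => (hgK y).trans (hgv y (mem_univ y))⟩
      have e1 := mem_ball_iff_norm.1 hy
      have e2 := norm_add_le x (y - x)
      rw [add_sub_cancel] at e2
      linarith)
  have hmax' : ∀ v : E n → ℝ, Continuous v →
      (∀ x, SubAt (fun x p r => H x p (lam * r)) (criticalValue H) v x) → v ≤ u :=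
    fun v hv hvs x => hmax v hv.continuousOn (fun y _ => hvs y) x (mem_univ x)
  refine ⟨u, ⟨⟨continuousOn_univ.1 huc, (isViscositySubsolution_iff isOpen_univ).2 husub, husup⟩,
    fun v hv => hmax' v hv.1 fun x => ?_⟩, hmax'⟩
  exact (isViscositySubsolution_iff isOpen_univ).1 hv.2.1 x (mem_univ x)

/-! ### Uniform upper bounds -/

/-- Discounted subsolutions in large balls are not large on the whole of a fixed ball. -/
lemma exists_le_one (h1 : AssumptionH1 H) (h2 : AssumptionH2 H) (h3 : AssumptionH3 H) {R₀ ε δ : ℝ}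
    (hε : 0 < ε) (hδ : 0 < δ) (hR₀ : 0 < R₀)
    (hfar : ∀ x : E n, R₀ ≤ ‖x‖ → ∀ p, ‖p‖ ≤ ε → H x p 0 ≤ criticalValue H - δ) :
    ∃ R₁, R₀ ≤ R₁ ∧ ∀ R, R₁ ≤ R → ∀ lam, 0 < lam → ∀ w : E n → ℝ, ContinuousOn w (ball 0 R) →
      (∀ x ∈ ball (0 : E n) R, SubAt (fun x p r => H x p (lam * r)) (criticalValue H) w x) →
        ∃ x : E n, ‖x‖ ≤ R₀ ∧ w x ≤ 1 := by
  obtain ⟨-, hcrit, -⟩ := exists_critical_data h1 h2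
  have hF := h1.regular_frozen 0
  obtain ⟨L₁, hL₁0, hL₁⟩ := hF.lipschitz_closedBall R₀ 0 (criticalValue H) hR₀
  obtain ⟨B, hB⟩ : ∃ B, B = L₁ * (2 * R₀) := ⟨_, rfl⟩
  have hB0 : 0 ≤ B := by rw [hB]; positivity
  obtain ⟨C, hC⟩ : ∃ C, C = B + 1 + ε * (1 + R₀) := ⟨_, rfl⟩
  obtain ⟨R₁, hR₁⟩ : ∃ R₁, R₁ = (C + 1) / ε := ⟨_, rfl⟩
  have hεR₁ : ε * R₁ = C + 1 := by rw [hR₁]; field_simp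
  have hR₀₁ : R₀ < R₁ := by
    refine lt_of_mul_lt_mul_left ?_ hε.le
    rw [hεR₁, hC]
    nlinarith
  obtain ⟨L, hL0, hL⟩ := h1.exists_coercive (R₁ + 1) 0 (criticalValue H)
  obtain ⟨κ, hκ, hrate⟩ := h3.exists_lower_rate L
  refine ⟨R₁ + 1, by linarith, fun R hR lam hlam w hwc hwsub => ?_⟩
  by_contra! hw1
  have hballR : ∀ x : E n, ‖x‖ < R₁ + 1 → x ∈ ball (0 : E n) R := fun x hx => by
    rw [mem_ball_zero_iff]; linarith
  have hsubset : closedBall (0 : E n) R₀ ⊆ ball 0 R := fun x hx =>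
    hballR x (by linarith [mem_closedBall_zero_iff.1 hx])
  obtain ⟨m, hm, hmin⟩ := (isCompact_closedBall (0 : E n) R₀).exists_isMinOn
    ⟨0, mem_closedBall_self hR₀.le⟩ (hwc.mono hsubset)
  have hm1 : 1 < w m := hw1 m (mem_closedBall_zero_iff.1 hm)
  have hsub0 : ∀ x ∈ ball (0 : E n) R, 0 ≤ w x →
      SubAt (fun x p (_ : ℝ) => H x p 0) (criticalValue H) w x := fun x hx hwx =>
    (hwsub x hx).imp fun p hp => (h1.monotone x p (by positivity)).trans hp
  have hosc : ∀ x : E n, ‖x‖ ≤ R₀ → w x - w m ≤ B := by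
    intro x hx
    have e1 := hL₁ w (hwc.mono hsubset)
      (fun y hy => hsub0 y (hsubset (ball_subset_closedBall hy))
        (by linarith [hw1 y (mem_ball_zero_iff.1 hy).le]))
      (fun y hy => by linarith [hw1 y (mem_ball_zero_iff.1 hy).le]) x
      (mem_closedBall_zero_iff.2 hx) m hm
    have e2 := norm_sub_le x m
    have e3 := mem_closedBall_zero_iff.1 hm
    have e4 : L₁ * ‖x - m‖ ≤ L₁ * (2 * R₀) := mul_le_mul_of_nonneg_left (by linarith) hL₁0
    linarith
  -- Where `w - w m ≥ -1 / 2`, one has `w ≥ 1 / 2`, so the discount gains `κ * lam / 2`; the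
  -- constant and the cone gain `δ`. The glued function thus beats the critical level by `δ'`.
  obtain ⟨δ', hδ'0, hδ'δ, hδ'κ⟩ : ∃ δ' > 0, δ' ≤ δ ∧ δ' ≤ κ * (lam / 2) :=
    ⟨min δ (κ * (lam / 2)), lt_min hδ (by positivity), min_le_left _ _, min_le_right _ _⟩
  obtain ⟨g, hg⟩ : ∃ g : E n → ℝ, g = fun y => w y + -w m := ⟨_, rfl⟩
  have hgc : ContinuousOn g (ball 0 (R₁ + 1)) := by
    rw [hg]
    exact (hwc.mono fun x hx => hballR x (mem_ball_zero_iff.1 hx)).add continuousOn_const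
  have hgsub : ∀ x : E n, ‖x‖ < R₁ + 1 → -1 / 2 ≤ g x →
      SubAt (fun x p (_ : ℝ) => H x p 0) (criticalValue H - δ') g x := by
    intro x hx hgx
    rw [hg] at hgx ⊢
    refine (hwsub x (hballR x hx)).add_const _ fun p hp => ?_
    have hwx : 1 / 2 ≤ w x := by linarith
    have hlw : lam / 2 ≤ lam * w x := by nlinarith
    have e1 := hL x hx.le p ((h1.monotone x p (by linarith)).trans hp)
    have e2 := hrate x p e1 0 (lam * w x) (by linarith)
    have e3 := mul_le_mul_of_nonneg_left hlw hκ.le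
    linarith
  have hg0 : ∀ x : E n, ‖x‖ ≤ R₀ → 0 ≤ g x := by
    intro x hx
    have : w m ≤ w x := hmin (mem_closedBall_zero_iff.2 hx)
    rw [hg]
    simp only
    linarith
  obtain ⟨hvc, hvsub⟩ := SubAt.glue (u := fun y => max (g y) (-1 / 2)) (ψ := cone C ε)
    (c := criticalValue H - δ') hF (R₀ := R₀) (R₁ := R₁) (R₂ := R₁ + 1)
    (by linarith) (by linarith) (fun x hx => Tendsto.max (hgc x hx) tendsto_const_nhds)
    (fun x hx => subAt_max_const (R₀ := R₀) (hgc.continuousAt (isOpen_ball.mem_nhds hx))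
      (hgsub x (mem_ball_zero_iff.1 hx))
      (fun hx' => by
        have := hfar x hx'.le 0 (by simpa using hε.le)
        linarith)
      (fun hx' => by linarith [hg0 x hx']))
    (contDiff_cone C ε)
    (fun x hx => by
      have := hfar x hx _ (norm_gradient_cone_le hε.le C x)
      linarith)
    (fun x hx => by
      have e1 := le_cone hε.le C x
      have e2 : ε * (1 + ‖x‖) ≤ ε * (1 + R₀) := mul_le_mul_of_nonneg_left (by linarith) hε.le
      have e3 := hosc x hx.le
      refine max_lt ?_ (by linarith)
      rw [hg]
      simp only
      linarith)
    (fun x hx _ => by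
      have e1 := cone_le hε.le C x
      have e2 : ε * R₁ ≤ ε * ‖x‖ := mul_le_mul_of_nonneg_left hx.le hε.le
      exact lt_of_lt_of_le (by linarith) (le_max_right _ _))
  have := hcrit _ _ hvc hvsub
  linarith

end HJ

/-! ### The maximal solution and the state-constraint solution agree at a given point -/

open HJ in
theorem theorem1p2 (n : ℕ) (H : HJ.E n → HJ.E n → ℝ → ℝ)
    (h1 : HJ.AssumptionH1 H) (h2 : HJ.AssumptionH2 H) (h3 : HJ.AssumptionH3 H)
    (hP : HJ.AssumptionP1 H ∨ HJ.AssumptionP2 H ∨ HJ.AssumptionP3 H) (z : HJ.E n) :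
    ∃ Rz : ℝ, 0 < Rz ∧ ∃ lz ∈ Set.Ioo (0 : ℝ) 1,
      ∀ R : ℝ, Rz ≤ R → ∀ lam ∈ Set.Ioo (0 : ℝ) lz,
        (∃ u : HJ.E n → ℝ, HJ.IsMaximalSolution H lam u) ∧
        (∃ w : HJ.E n → ℝ, HJ.IsStateConstraintSolution H lam R w) ∧
        ∀ u w : HJ.E n → ℝ, HJ.IsMaximalSolution H lam u →
          HJ.IsStateConstraintSolution H lam R w → u z = w z := by
  obtain ⟨-, -, ε, hε, δ, hδ, R₀, hR₀, hfar⟩ := exists_critical_data h1 h2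
  obtain ⟨K, hK0, hK⟩ := exists_discounted_subsolution h1 h2 h3
  obtain ⟨R₁, hR₀₁, hR₁⟩ := exists_le_one h1 h2 h3 hε hδ hR₀ hfar
  obtain ⟨R₃, hR₃⟩ : ∃ R₃, R₃ = max R₀ ‖z‖ + 1 := ⟨_, rfl⟩
  have hR₃0 : R₀ < R₃ := by rw [hR₃]; linarith [le_max_left R₀ ‖z‖]
  have hR₃z : ‖z‖ < R₃ := by rw [hR₃]; linarith [le_max_right R₀ ‖z‖]
  -- Freezing the value at `-K`, below `lam * w` for every `lam < 1`, makes the Lipschitz constant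
  -- independent of `lam` and `R`.
  obtain ⟨L, hL0, hL⟩ := (h1.regular_frozen (-K)).exists_lipschitz_const R₃ (-K) (criticalValue H)
  obtain ⟨C, hC⟩ : ∃ C, C = (1 + L * (2 * R₃)) + 1 + ε * (1 + R₃) := ⟨_, rfl⟩
  have hLR : 0 ≤ L * (2 * R₃) := mul_nonneg hL0 (by linarith)
  have hC0 : 0 < C := by
    have : 0 < ε * (1 + R₃) := mul_pos hε (by linarith)
    linarith
  -- Beyond this radius the cone is below `-K`, hence below `w`.
  obtain ⟨R₄, hR₄⟩ : ∃ R₄, R₄ = (C + K + 1) / ε := ⟨_, rfl⟩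
  have hεR₄ : ε * R₄ = C + K + 1 := by rw [hR₄]; field_simp
  obtain ⟨κ, hκ, hrate⟩ := h3.exists_upper_rate ε
  have hκC : 0 < κ * C := mul_pos hκ hC0
  -- With `lam * κ * C ≤ δ`, the discount term on the cone uses up at most the margin available at
  -- infinity.
  obtain ⟨lz, hlz0, hlz⟩ := exists_between (lt_min one_pos (div_pos hδ hκC))
  have hlz1 : lz < 1 := hlz.trans_le (min_le_left _ _)
  have hlzδ : lz < δ / (κ * C) := hlz.trans_le (min_le_right _ _)
  refine ⟨max R₁ (max R₃ (R₄ + 1)), lt_max_of_lt_left (by linarith), lz, ⟨hlz0, hlz1⟩,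
    fun R hR lam hlam => ?_⟩
  obtain ⟨hlam0, hlamz⟩ := hlam
  have hRR₁ : R₁ ≤ R := (le_max_left _ _).trans hR
  have hRR₃ : R₃ ≤ R := ((le_max_left _ _).trans (le_max_right _ _)).trans hR
  have hRR₄ : R₄ < R := by
    have : R₄ + 1 ≤ R := ((le_max_right _ _).trans (le_max_right _ _)).trans hR
    linarith
  have hR0 : 0 < R := by linarith
  obtain ⟨u', hu', hu'max⟩ := exists_maximalSolution h1 h2 h3 hlam0
  refine ⟨⟨u', hu'⟩, exists_stateConstraintSolution h1 h2 h3 hlam0 hR0, fun u w hu hw => ?_⟩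
  have hF := h1.regular_discounted hlam0.le
  have hS := h3.strictInValue_discounted hlam0
  obtain ⟨hwc, hwsub, hwsup⟩ := hw
  rw [isViscositySubsolution_iff isOpen_ball] at hwsub
  have huu' : u = u' := hu.unique hu'
  have hzR : ‖z‖ < R := by linarith
  apply le_antisymm
  · obtain ⟨huc, husub, -⟩ := hu.1
    rw [isViscositySubsolution_iff isOpen_univ] at husub
    exact comparison_closedBall hF hS hR0 huc.continuousOn (fun x _ => husub x (mem_univ x)) hwc
      hwsup z (mem_closedBall_zero_iff.2 hzR.le)
  · obtain ⟨g, hgc, hgK, hgsub⟩ := hK lam hlam0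
    have hwK : ∀ x : E n, ‖x‖ < R → -K ≤ w x := fun x hx =>
      (hgK x).trans (comparison_closedBall hF hS hR0 hgc.continuousOn (fun x _ => hgsub x) hwc
        hwsup x (mem_closedBall_zero_iff.2 hx.le))
    obtain ⟨x₁, hx₁, hwx₁⟩ := hR₁ R hRR₁ lam hlam0 w (hwc.mono ball_subset_closedBall) hwsub
    have hwC : ∀ x : E n, ‖x‖ < R₃ → w x ≤ 1 + L * (2 * R₃) := by
      intro x hx
      have hsubset : ball (0 : E n) R₃ ⊆ ball 0 R := ball_subset_ball hRR₃
      have e1 := hL (ball 0 R₃) isOpen_ball (convex_ball 0 R₃)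
        (fun y hy => (mem_ball_zero_iff.1 hy).le) w
        (hwc.mono (hsubset.trans ball_subset_closedBall))
        (fun y hy => (hwsub y (hsubset hy)).imp fun p hp => by
          refine (h1.monotone y p ?_).trans hp
          have := hwK y (mem_ball_zero_iff.1 (hsubset hy))
          nlinarith)
        (fun y hy => hwK y (mem_ball_zero_iff.1 (hsubset hy))) x (mem_ball_zero_iff.2 hx) x₁
        (mem_ball_zero_iff.2 (by linarith))
      have e2 := norm_sub_le x x₁
      have e3 : L * ‖x - x₁‖ ≤ L * (2 * R₃) := mul_le_mul_of_nonneg_left (by linarith) hL0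
      linarith
    have hcone : ∀ x : E n, ‖x‖ < R₃ → w x < cone C ε x := by
      intro x hx
      have e1 := le_cone hε.le C x
      have e2 : ε * (1 + ‖x‖) ≤ ε * (1 + R₃) := mul_le_mul_of_nonneg_left (by linarith) hε.le
      linarith [hwC x hx]
    obtain ⟨hvc, hvsub⟩ := SubAt.glue (u := w) (ψ := cone C ε) hF (R₀ := R₃) (R₁ := R₄) (R₂ := R)
      hRR₄ hRR₃ (hwc.mono ball_subset_closedBall) hwsub (contDiff_cone C ε)
      (fun x hx => by
        have hgrad := norm_gradient_cone_le hε.le C x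
        have e1 := hfar x (by linarith) _ hgrad
        have e2 : cone C ε x ≤ C := by
          have := cone_le hε.le C x
          have : 0 ≤ ε * ‖x‖ := by positivity
          linarith
        have e3 := h1.monotone x (gradient (cone C ε) x) (mul_le_mul_of_nonneg_left e2 hlam0.le)
        have e4 := hrate x _ hgrad 0 (lam * C) (by positivity)
        have e5 : lam * (κ * C) ≤ δ := ((lt_div_iff₀ hκC).1 (hlamz.trans hlzδ)).le
        linarith)
      hcone
      (fun x hx hx' => by
        have e1 := cone_le hε.le C x
        have e2 : ε * R₄ ≤ ε * ‖x‖ := mul_le_mul_of_nonneg_left hx.le hε.le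
        linarith [hwK x hx'])
    have hfin := hu'max _ hvc hvsub z
    simp only [if_pos hzR, min_eq_left (hcone z hR₃z).le] at hfin
    rwa [huu']
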